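/- Let $d\ge 1$ be an integer. For $N$ with $dN$ even, let $G_N$ be the random $d$-regular multigraph on $N$ vertices given by the configuration model (each vertex has $d$ half-edges, and the $dN$ half-edges are matched uniformly at random into $dN/2$ edges). A set $I$ of vertices is independent if no edge has both its endpoints in $I$ (so no vertex of $I$ carries a loop). Put $$\alpha^*=\limsup_{N\to\infty,\ dN\text{ even}}\ \frac1N\,\mathbb E\Big[\max\{|I| : I\text{ independent in }G_N\}\Big]$$ (this is the limit whenever the limit exists). (i) For every $\lambda>0$ (in particular for every fugacity $\lambda>1$) and every probability measure $\eta$ on $(0,1)$, if $\pi_1,\pi_2,\dots$ are i.i.d. with law $\eta$, then $$\alpha^*\log\lambda\ \le\ \mathbb E\log\Big(1+\lambda\prod_{i=1}^d(1-\pi_i)\Big)-\frac d2\,\mathbb E\log(1-\pi_1\pi_2),$$ where the right-hand side may be $+\infty$. (ii) For $\lambda>0$, $\pi\in(0,1)$ and $\alpha\in\mathbb R$ let $$\Phi(\lambda,\pi,\alpha)=\log\big(1+\lambda(1-\pi)^d\big)-\frac d2\log(1-\pi^2)-\alpha\log\lambda,\qquad \Phi_d(\alpha)=\inf_{\lambda>0,\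 \pi\in(0,1)}\Phi(\lambda,\pi,\alpha)\in[-\infty,\infty),$$ and let $\alpha_{RS}=\inf\{\alpha>0:\Phi_d(\alpha)<0\}$. Then $\alpha^*\le\alpha_{RS}$. (iii) For $0<\alpha<\frac12$, $\Phi_d(\alpha)$ is the first-moment function: $$\Phi_d(\alpha)=H(\alpha)-d\Big(\tfrac12(1-2\alpha)\log(1-2\alpha)-(1-\alpha)\log(1-\alpha)\Big),\qquad H(\alpha)=-\alpha\log\alpha-(1-\alpha)\log(1-\alpha).$$ If $d\ge3$, then $0<\alpha_{RS}<\frac12$, and $\alpha_{RS}$ is the infimum of those $\alpha\in(0,\frac12)$ at which this explicit expression is negative. -/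

import Mathlib

open MeasureTheory Filter

namespace HardCore

/-- A configuration (complete matching of half-edges) for a `d`-regular multigraph on the vertex
set `Fin N`: a bijection between the `2 * (d * N / 2)` edge half-edges (edge `k` has the half-edges
`(k, 0)` and `(k, 1)`) and the `N * d` vertex half-edges (vertex `v` has the half-edges `(v, j)`).
The type is non-empty exactly when `d * N` is even. -/
abbrev Config (d N : ℕ) : Type := (Fin (d * N / 2) × Fin 2) ≃ (Fin N × Fin d)

/-- The endpoint number `s` of the edge `k` of the multigraph given by a configuration. -/
def endpoint {d N : ℕ} (m : Config d N) (k : Fin (d * N / 2)) (s : Fin 2) : Fin N := (m (k, s)).1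

/-- A set of vertices is independent if no edge has both its endpoints in it (in particular, it
contains no vertex that carries a loop). -/
def IsIndep {d N : ℕ} (m : Config d N) (I : Finset (Fin N)) : Prop :=
  ∀ k : Fin (d * N / 2), ¬ (endpoint m k 0 ∈ I ∧ endpoint m k 1 ∈ I)

instance {d N : ℕ} (m : Config d N) (I : Finset (Fin N)) : Decidable (IsIndep m I) :=
  inferInstanceAs (Decidable (∀ k : Fin (d * N / 2), ¬ (endpoint m k 0 ∈ I ∧ endpoint m k 1 ∈ I)))

/-- The size of a largest independent set. -/
def maxIndep {d N : ℕ} (m : Config d N) : ℕ :=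
  (Finset.univ.filter (fun I : Finset (Fin N) => IsIndep m I)).sup Finset.card

/-- `(1/N) * E[max |I|]`, where the expectation is over a uniformly random configuration. -/
noncomputable def meanRatio (d N : ℕ) : ℝ :=
  ((∑ m : Config d N, (maxIndep m : ℝ)) / (Fintype.card (Config d N) : ℝ)) / (N : ℝ)

/-- The asymptotic independence ratio `α*` of random `d`-regular multigraphs: the upper limit of
`(1/N) * E[max |I|]` as `N → ∞` along the `N` with `d * N` even. All these ratios lie in `[0, 1]`. -/
noncomputable def alphaStar (d : ℕ) : ℝ :=
  limsup (fun N : ℕ => meanRatio d N) (atTop ⊓ 𝓟 {N : ℕ | Even (d * N)})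

/-- `E log (1 + l * ∏_{i ≤ d} (1 - π_i)) - (d/2) * E log (1 - π_1 * π_2)` for i.i.d. `π_i` of
law `η` on `(0, 1)`. The first expectation is that of a bounded function. The random variable
`- log (1 - π_1 * π_2)` is positive, and its expectation, possibly `+∞`, is a Lebesgue integral. -/
noncomputable def rsBound (d : ℕ) (l : ℝ) (η : Measure ℝ) : EReal :=
  ((∫ p : Fin d → ℝ, Real.log (1 + l * ∏ i, (1 - p i)) ∂(Measure.pi fun _ => η) : ℝ) : EReal)
    + (((d : ℝ) / 2 : ℝ) : EReal) *
      ((∫⁻ q : ℝ × ℝ, ENNReal.ofReal (-Real.log (1 - q.1 * q.2)) ∂(η.prod η) : ENNReal) : EReal)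

/-- `Φ(l, p, a) = log (1 + l (1 - p)^d) - (d/2) log (1 - p^2) - a log l`. -/
noncomputable def phi (d : ℕ) (l p a : ℝ) : ℝ :=
  Real.log (1 + l * (1 - p) ^ d) - (d : ℝ) / 2 * Real.log (1 - p ^ 2) - a * Real.log l

/-- `Φ_d(a) = inf Φ(l, p, a)` over `l ∈ (0, ∞)` and `p ∈ (0, 1)`, with values in `[-∞, ∞]`. -/
noncomputable def phiInf (d : ℕ) (a : ℝ) : EReal :=
  ⨅ l ∈ Set.Ioi (0 : ℝ), ⨅ p ∈ Set.Ioo (0 : ℝ) 1, ((phi d l p a : ℝ) : EReal)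

/-- `α_RS = inf {a > 0 : Φ_d(a) < 0}`. -/
noncomputable def alphaRS (d : ℕ) : ℝ :=
  sInf {a : ℝ | 0 < a ∧ phiInf d a < 0}

/-- The entropy `H(a) = - a log a - (1 - a) log (1 - a)`. -/
noncomputable def entropyH (a : ℝ) : ℝ := -a * Real.log a - (1 - a) * Real.log (1 - a)

/-- The first-moment function
`H(a) - d ((1/2) (1 - 2a) log (1 - 2a) - (1 - a) log (1 - a))`. -/
noncomputable def firstMoment (d : ℕ) (a : ℝ) : ℝ :=
  entropyH a - (d : ℝ) *
    (1 / 2 * (1 - 2 * a) * Real.log (1 - 2 * a) - (1 - a) * Real.log (1 - a))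

end HardCore

/-!
The theorem rests on an interpolation between the random multigraph and a system of independent
vertices. Give a set `I` of vertices the weight `l ^ #I` if it is independent and `0` otherwise; for
`1 < l` the logarithm of the partition function is at least `maxIndep * log l`, so it suffices to
bound its mean from above. The edges of the configuration are removed one at a time, and every
removed edge is replaced by two external fields, independent copies of `X`, each acting on one
half-edge and multiplying the weight by `1 - X` when the vertex of that half-edge is occupied. With
no edges left the vertices are independent, and the partition function factorises into
`1 + l * ∏ (1 - X_i)`, which gives the first term of the replica-symmetric functional
(`freeEnergy_fields`).

A single step compares joining two uniformly chosen free half-edges with putting a field on a free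
half-edge. Expanding the logarithms in power series and writing powers of Gibbs averages as averages
over independent replicas, the difference becomes a sum of squares: the kernel `-log (1 - ⟨u, v⟩)` is
positive semidefinite (`replica_inequality`). The two half-edges joined by an edge are distinct, while
the square contains the diagonal; with `r` free half-edges this costs an error of order `1 / r`
(`freeEnergy_step`), since no increment exceeds `log (1 + l)` in absolute value.

The vertex degrees being fixed, the averaging is only over the free half-edges, so their number has
to be kept under control. The step inequality is read as follows: the states obtained by removing one
field, and adding an edge with probability `1 / 2`, have average free energy at most that of the
initial state, up to half the edge term of the functional and the error. Along these moves the number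
of free half-edges is a simple random walk reflected at `0`, so that the errors `1 / r` are negligible
on average. This is expressed without probability by a barrier function of `r` that is bounded below
independently of `N` (`exists_barrier`, `freeEnergy_interpolation`).

For `l ≤ 1` the bound is a matter of signs. Its case of a Dirac mass gives `alphaStar ≤ alphaRS`.
The infimum defining `phiInf` separates, with `y = l (1 - p) ^ d`, into two one-variable problems with
the common minimiser `y = p = a / (1 - a)`; both lower bounds are instances of `log x ≤ x - 1`.
-/

namespace HardCore

/-! ### The first-moment function -/

/-- Gibbs' variational principle for a Bernoulli variable: `H(a)` is the infimum over `y` of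
`log (1 + y) - a log y`, attained at `y = a / (1 - a)`. -/
lemma entropyH_le {a y : ℝ} (ha0 : 0 < a) (ha1 : a < 1) (hy : 0 < y) :
    entropyH a ≤ Real.log (1 + y) - a * Real.log y := by
  have h1 : 0 < 1 - a := by linarith
  have e1 : Real.log (y / ((1 + y) * a)) = Real.log y - Real.log (1 + y) - Real.log a := by
    rw [Real.log_div (by positivity) (by positivity), Real.log_mul (by positivity) (by positivity)]
    ring
  have e2 : Real.log (1 / ((1 + y) * (1 - a))) = - Real.log (1 + y) - Real.log (1 - a) := by
    rw [Real.log_div (by positivity) (by positivity), Real.log_mul (by positivity) (by positivity),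
      Real.log_one]
    ring
  have i1 := mul_le_mul_of_nonneg_left
    (Real.log_le_sub_one_of_pos (x := y / ((1 + y) * a)) (by positivity)) ha0.le
  have i2 := mul_le_mul_of_nonneg_left
    (Real.log_le_sub_one_of_pos (x := 1 / ((1 + y) * (1 - a))) (by positivity)) h1.le
  rw [e1] at i1
  rw [e2] at i2
  have e3 : a * (y / ((1 + y) * a) - 1) + (1 - a) * (1 / ((1 + y) * (1 - a)) - 1) = 0 := by
    field_simp
    ring
  unfold entropyH
  nlinarith

/-- The edge term of `phi`, minimised over the field: the minimum is attained at
`p = a / (1 - a)`. -/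
lemma edgeTerm_le {a p : ℝ} (ha0 : 0 < a) (ha1 : a < 1 / 2) (hp0 : 0 < p) (hp1 : p < 1) :
    -(1 / 2 * (1 - 2 * a) * Real.log (1 - 2 * a) - (1 - a) * Real.log (1 - a)) ≤
      a * Real.log (1 - p) - 1 / 2 * Real.log (1 - p ^ 2) := by
  have h1 : 0 < 1 - a := by linarith
  have h2 : 0 < 1 - 2 * a := by linarith
  have h3 : 0 < 1 - p := by linarith
  have h4 : 0 < 1 + p := by linarith
  have e0 : Real.log (1 - p ^ 2) = Real.log (1 - p) + Real.log (1 + p) := by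
    rw [← Real.log_mul h3.ne' h4.ne']; ring_nf
  have e1 : Real.log ((1 - p) * (1 - a) / (1 - 2 * a)) =
      Real.log (1 - p) + Real.log (1 - a) - Real.log (1 - 2 * a) := by
    rw [Real.log_div (by positivity) (by positivity), Real.log_mul (by positivity) (by positivity)]
  have e2 : Real.log ((1 + p) * (1 - a)) = Real.log (1 + p) + Real.log (1 - a) :=
    Real.log_mul (by positivity) (by positivity)
  have i1 := mul_le_mul_of_nonneg_left
    (Real.log_le_sub_one_of_pos (x := (1 - p) * (1 - a) / (1 - 2 * a)) (by positivity)) h2.le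
  have i2 := Real.log_le_sub_one_of_pos (x := (1 + p) * (1 - a)) (by positivity)
  rw [e1] at i1
  rw [e2] at i2
  have e3 : (1 - 2 * a) * ((1 - p) * (1 - a) / (1 - 2 * a) - 1) + ((1 + p) * (1 - a) - 1) = 0 := by
    field_simp
    ring
  rw [e0]
  nlinarith

lemma firstMoment_le_phi {d : ℕ} {a l p : ℝ} (ha0 : 0 < a) (ha1 : a < 1 / 2) (hl : 0 < l)
    (hp0 : 0 < p) (hp1 : p < 1) : firstMoment d a ≤ phi d l p a := by
  have h3 : 0 < 1 - p := by linarith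
  have i1 := entropyH_le (y := l * (1 - p) ^ d) ha0 (by linarith) (by positivity)
  have i2 := mul_le_mul_of_nonneg_left (edgeTerm_le ha0 ha1 hp0 hp1) (Nat.cast_nonneg (α := ℝ) d)
  rw [Real.log_mul (by positivity) (by positivity), Real.log_pow] at i1
  unfold firstMoment phi
  nlinarith

/-- Equality holds at `p = a / (1 - a)` and at the `l` for which `l (1 - p) ^ d = a / (1 - a)`. -/
lemma phi_minimizer {d : ℕ} {a : ℝ} (ha0 : 0 < a) (ha1 : a < 1 / 2) :
    phi d (a / (1 - a) / ((1 - 2 * a) / (1 - a)) ^ d) (a / (1 - a)) a = firstMoment d a := by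
  have h1 : 0 < 1 - a := by linarith
  have h2 : 0 < 1 - 2 * a := by linarith
  have e1 : 1 - a / (1 - a) = (1 - 2 * a) / (1 - a) := by field_simp; ring
  have e2 : 1 - (a / (1 - a)) ^ 2 = (1 - 2 * a) / (1 - a) ^ 2 := by field_simp; ring
  have e3 : 1 + a / (1 - a) = 1 / (1 - a) := by field_simp; ring
  unfold phi firstMoment entropyH
  rw [e1, e2, div_mul_cancel₀ _ (by positivity), e3,
    Real.log_div (by positivity) (by positivity), Real.log_div (by positivity) (by positivity),
    Real.log_div (by positivity) (by positivity), Real.log_div (by positivity) (by positivity),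
    Real.log_pow, Real.log_pow, Real.log_div (by positivity) (by positivity), Real.log_one]
  push_cast
  ring

lemma phiInf_eq_firstMoment {d : ℕ} {a : ℝ} (ha : a ∈ Set.Ioo (0 : ℝ) (1 / 2)) :
    phiInf d a = ((firstMoment d a : ℝ) : EReal) := by
  obtain ⟨ha0, ha1⟩ := ha
  have h1 : 0 < 1 - a := by linarith
  have h2 : 0 < 1 - 2 * a := by linarith
  refine le_antisymm ?_ ?_
  · rw [← phi_minimizer ha0 ha1]
    refine (iInf₂_le _ (Set.mem_Ioi.2 (by positivity))).trans
      (iInf₂_le (a / (1 - a)) ⟨by positivity, ?_⟩)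
    rw [div_lt_one h1]; linarith
  · refine le_iInf₂ fun l hl => le_iInf₂ fun p hp => ?_
    exact EReal.coe_le_coe_iff.2 (firstMoment_le_phi ha0 ha1 hl hp.1 hp.2)

lemma phiInf_lt_zero_iff {d : ℕ} {a : ℝ} :
    phiInf d a < 0 ↔ ∃ l p : ℝ, 0 < l ∧ 0 < p ∧ p < 1 ∧ phi d l p a < 0 := by
  simp only [phiInf, iInf_lt_iff, Set.mem_Ioi, Set.mem_Ioo, exists_prop]
  constructor
  · rintro ⟨l, hl, p, hp, h⟩
    exact ⟨l, p, hl, hp.1, hp.2, by exact_mod_cast h⟩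
  · rintro ⟨l, p, hl, hp, hp', h⟩
    exact ⟨l, hl, p, ⟨hp, hp'⟩, by exact_mod_cast h⟩

/-- Near `0` the entropy term `-a log a` dominates the linear term `-d a`. -/
lemma firstMoment_nonneg {d : ℕ} {a : ℝ} (ha0 : 0 < a) (ha1 : a < 1 / 2)
    (h : a ≤ Real.exp (-d)) : 0 ≤ firstMoment d a := by
  have h1 : 0 < 1 - a := by linarith
  have h2 : 0 < 1 - 2 * a := by linarith
  have l1 : Real.log a ≤ -d := by
    rw [← Real.log_exp (-(d : ℝ))]; exact Real.log_le_log ha0 h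
  have l2 : Real.log (1 - 2 * a) ≤ 0 := Real.log_nonpos h2.le (by linarith)
  have l3 : Real.log (1 - a) ≤ 0 := Real.log_nonpos h1.le (by linarith)
  have l4 : -((1 - a) * Real.log (1 - a)) ≤ a := by
    have := Real.one_sub_inv_le_log_of_pos h1
    have := mul_le_mul_of_nonneg_left this h1.le
    rw [mul_sub, mul_inv_cancel₀ h1.ne'] at this
    linarith
  have l5 : 0 ≤ -((1 - a) * Real.log (1 - a)) := by nlinarith
  have l6 : 1 / 2 * (1 - 2 * a) * Real.log (1 - 2 * a) ≤ 0 := by nlinarith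
  have hd : (0 : ℝ) ≤ d := Nat.cast_nonneg d
  unfold firstMoment entropyH
  nlinarith [mul_le_mul_of_nonneg_left (add_le_add l6 l4) hd, mul_le_mul_of_nonneg_left l1 ha0.le]

/-- At `a = 1 / 2` the first-moment function is `(1 - d / 2) log 2`, which is negative for
`3 ≤ d`. -/
lemma exists_firstMoment_neg {d : ℕ} (hd : 3 ≤ d) :
    ∃ a ∈ Set.Ioo (0 : ℝ) (1 / 2), firstMoment d a < 0 := by
  have hc : Continuous (firstMoment d) := by
    have h := Real.continuous_mul_log
    have h1 : Continuous fun a : ℝ => (1 - a) * Real.log (1 - a) :=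
      h.comp (continuous_const.sub continuous_id)
    have h2 : Continuous fun a : ℝ => (1 - 2 * a) * Real.log (1 - 2 * a) :=
      h.comp (continuous_const.sub (continuous_const.mul continuous_id))
    have : firstMoment d = fun a => -(a * Real.log a) - (1 - a) * Real.log (1 - a) - (d : ℝ) *
        (1 / 2 * ((1 - 2 * a) * Real.log (1 - 2 * a)) - (1 - a) * Real.log (1 - a)) := by
      funext a; unfold firstMoment entropyH; ring
    rw [this]
    fun_prop
  have hneg : firstMoment d (1 / 2) < 0 := by
    have h3 : (3 : ℝ) ≤ d := by exact_mod_cast hd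
    have hl : Real.log (1 / 2) < 0 := Real.log_neg (by norm_num) (by norm_num)
    have : firstMoment d (1 / 2) = ((d : ℝ) / 2 - 1) * Real.log (1 / 2) := by
      unfold firstMoment entropyH
      norm_num
      ring
    rw [this]
    nlinarith
  have hev : ∀ᶠ a in nhdsWithin (1 / 2 : ℝ) (Set.Iio (1 / 2)), firstMoment d a < 0 :=
    (hc.continuousAt.eventually (Iio_mem_nhds hneg)).filter_mono nhdsWithin_le_nhds
  obtain ⟨a, h, h'⟩ := (hev.and (Ioo_mem_nhdsLT (show (0 : ℝ) < 1 / 2 by norm_num))).exists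
  exact ⟨a, h', h⟩

lemma alphaRS_eq_sInf {d : ℕ} (hd : 3 ≤ d) :
    alphaRS d = sInf {a : ℝ | a ∈ Set.Ioo (0 : ℝ) (1 / 2) ∧ firstMoment d a < 0} := by
  obtain ⟨b, hb, hbn⟩ := exists_firstMoment_neg hd
  have key : ∀ a ∈ Set.Ioo (0 : ℝ) (1 / 2), (phiInf d a < 0 ↔ firstMoment d a < 0) := by
    intro a ha
    rw [phiInf_eq_firstMoment ha]
    exact_mod_cast Iff.rfl
  have bdd : BddBelow {a : ℝ | a ∈ Set.Ioo (0 : ℝ) (1 / 2) ∧ firstMoment d a < 0} :=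
    ⟨0, fun a ha => ha.1.1.le⟩
  refine le_antisymm ?_ ?_
  · refine csInf_le_csInf ⟨0, fun a ha => ha.1.le⟩ ⟨b, hb, hbn⟩ ?_
    exact fun a ha => ⟨ha.1.1, (key a ha.1).2 ha.2⟩
  · refine le_csInf ⟨b, hb.1, (key b hb).2 hbn⟩ fun a ha => ?_
    rcases lt_or_ge a (1 / 2) with h | h
    · exact csInf_le bdd ⟨⟨ha.1, h⟩, (key a ⟨ha.1, h⟩).1 ha.2⟩
    · exact (csInf_le bdd ⟨hb, hbn⟩).trans (hb.2.le.trans h)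

lemma alphaRS_mem_Ioo {d : ℕ} (hd : 3 ≤ d) : alphaRS d ∈ Set.Ioo (0 : ℝ) (1 / 2) := by
  obtain ⟨b, hb, hbn⟩ := exists_firstMoment_neg hd
  rw [alphaRS_eq_sInf hd]
  constructor
  · refine (Real.exp_pos (-d)).trans_le (le_csInf ⟨b, hb, hbn⟩ fun a ha => ?_)
    by_contra h
    exact absurd ha.2 (not_lt.2 (firstMoment_nonneg ha.1.1 ha.1.2 (not_le.1 h).le))
  · refine lt_of_le_of_lt (csInf_le ?_ ⟨hb, hbn⟩) hb.2
    exact ⟨0, fun a ha => ha.1.1.le⟩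

/-! ### The replica inequality -/

section Replica

variable {S P Ω : Type*} [Fintype S] [MeasurableSpace Ω]

/-- The moment form of the replica inequality: expanding the square, this is the expectation of
`(∑ a, ∏ r, g a (s r) - #T * m) ^ 2` over `k` independent replicas `s r` of law `w`. -/
lemma replica_moment_nonneg (w : S → ℝ) (hw : ∀ s, 0 ≤ w s) (hw1 : ∑ s, w s = 1) (T : Finset P)
    (g : P → S → ℝ) (m : ℝ) (k : ℕ) :
    0 ≤ ∑ a ∈ T, ∑ b ∈ T, (∑ s, w s * (g a s * g b s)) ^ k
      - 2 * (T.card * ∑ a ∈ T, m * (∑ s, w s * g a s) ^ k) + (T.card : ℝ) ^ 2 * m ^ 2 := by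
  classical
  have key : ∀ f : S → ℝ, (∑ s, w s * f s) ^ k =
      ∑ t : Fin k → S, (∏ r, w (t r)) * ∏ r, f (t r) := by
    intro f
    rw [Finset.sum_pow', Fintype.piFinset_univ]
    exact Finset.sum_congr rfl fun t _ => Finset.prod_mul_distrib
  have hone : ∑ t : Fin k → S, ∏ r, w (t r) = 1 := by
    have := key fun _ => 1
    simpa [hw1] using this.symm
  have hsq : 0 ≤ ∑ t : Fin k → S, (∏ r, w (t r)) *
      (∑ a ∈ T, ∏ r, g a (t r) - T.card * m) ^ 2 :=
    Finset.sum_nonneg fun t _ => mul_nonneg (Finset.prod_nonneg fun r _ => hw _) (sq_nonneg _)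
  convert hsq using 1
  have e1 : ∑ a ∈ T, ∑ b ∈ T, (∑ s, w s * (g a s * g b s)) ^ k =
      ∑ t : Fin k → S, (∏ r, w (t r)) * (∑ a ∈ T, ∏ r, g a (t r)) ^ 2 := by
    simp only [key, Finset.prod_mul_distrib, sq, Finset.sum_mul_sum]
    simp only [Finset.mul_sum]
    exact (Finset.sum_congr rfl fun a _ => Finset.sum_comm).trans Finset.sum_comm
  have e2 : ∑ a ∈ T, m * (∑ s, w s * g a s) ^ k =
      ∑ t : Fin k → S, (∏ r, w (t r)) * (m * ∑ a ∈ T, ∏ r, g a (t r)) := by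
    simp only [key, Finset.mul_sum]
    rw [Finset.sum_comm]
    refine Finset.sum_congr rfl fun t _ => Finset.sum_congr rfl fun a _ => by ring
  have e3 : (T.card : ℝ) ^ 2 * m ^ 2 =
      ∑ t : Fin k → S, (∏ r, w (t r)) * ((T.card : ℝ) ^ 2 * m ^ 2) := by
    rw [← Finset.sum_mul, hone, one_mul]
  rw [e1, e2, e3, Finset.mul_sum, Finset.mul_sum, ← Finset.sum_sub_distrib,
    ← Finset.sum_add_distrib]
  exact Finset.sum_congr rfl fun t _ => by ring

/-- Integration of `-log (1 - x) = ∑ x ^ (n + 1) / (n + 1)` term by term. -/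
lemma hasSum_integral_neg_log {μ : Measure Ω} {X : Ω → ℝ} (hX : Measurable X)
    (hX01 : ∀ y, X y ∈ Set.Ico (0 : ℝ) 1)
    (hi : Integrable (fun y => -Real.log (1 - X y)) μ) :
    HasSum (fun n : ℕ => (∫ y, X y ^ (n + 1) ∂μ) / (n + 1)) (∫ y, -Real.log (1 - X y) ∂μ) := by
  have hs : ∀ y, HasSum (fun n : ℕ => X y ^ (n + 1) / (n + 1)) (-Real.log (1 - X y)) := fun y =>
    Real.hasSum_pow_div_log_of_abs_lt_one (by rw [abs_of_nonneg (hX01 y).1]; exact (hX01 y).2)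
  have := hasSum_integral_of_dominated_convergence (μ := μ)
    (F := fun (n : ℕ) y => X y ^ (n + 1) / ((n : ℝ) + 1)) (f := fun y => -Real.log (1 - X y))
    (fun (n : ℕ) y => X y ^ (n + 1) / ((n : ℝ) + 1))
    (fun n => ((hX.pow_const _).div_const _).aestronglyMeasurable)
    (fun n => Eventually.of_forall fun y => by
      rw [Real.norm_of_nonneg]
      exact div_nonneg (pow_nonneg (hX01 y).1 _) (by positivity))
    (Eventually.of_forall fun y => (hs y).summable)
    (by simpa only [(hs _).tsum_eq] using hi)
    (Eventually.of_forall hs)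
  simpa only [integral_div] using this

/-- For `0 ≤ X < 1` and `t < 1` the variable `log (1 - X t)` is bounded, hence integrable. -/
lemma integrable_log_one_sub_mul {μ : Measure Ω} [IsProbabilityMeasure μ] {X : Ω → ℝ}
    (hX : Measurable X) (hX01 : ∀ y, X y ∈ Set.Ioo (0 : ℝ) 1) {t : ℝ} (ht0 : 0 ≤ t) (ht1 : t < 1) :
    Integrable (fun y => Real.log (1 - X y * t)) μ := by
  refine Integrable.of_bound (Real.measurable_log.comp
    (measurable_const.sub (hX.mul_const t))).aestronglyMeasurable (-Real.log (1 - t))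
    (Eventually.of_forall fun y => ?_)
  have h1 : X y * t ≤ t := mul_le_of_le_one_left ht0 (hX01 y).2.le
  have h0 : 0 ≤ X y * t := mul_nonneg (hX01 y).1.le ht0
  rw [Real.norm_of_nonpos (Real.log_nonpos (by linarith) (by linarith))]
  exact neg_le_neg (Real.log_le_log (by linarith) (by linarith))

/-- The kernel `-log (1 - ⟨u, v⟩)` is positive semidefinite on the unit ball of `L²(w)`. It is
applied to the signed measure giving mass `1 / #T` to each spin `g a`, `a ∈ T`, and mass `-1` to
the random constant function `X`. -/
lemma replica_inequality {μ : Measure Ω} [IsProbabilityMeasure μ] {X : Ω → ℝ}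
    (hX : Measurable X) (hX01 : ∀ y, X y ∈ Set.Ioo (0 : ℝ) 1)
    (hi : Integrable (fun y : Ω × Ω => -Real.log (1 - X y.1 * X y.2)) (μ.prod μ))
    (w : S → ℝ) (hw : ∀ s, 0 ≤ w s) (hw1 : ∑ s, w s = 1) (T : Finset P)
    (g : P → S → ℝ) (hg0 : ∀ a s, 0 ≤ g a s) (hg1 : ∀ a s, g a s ≤ 1)
    (hlt : ∀ a ∈ T, ∑ s, w s * g a s < 1) :
    ∑ a ∈ T, ∑ b ∈ T, Real.log (1 - ∑ s, w s * (g a s * g b s)) ≤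
      2 * (T.card * ∑ a ∈ T, ∫ y, Real.log (1 - X y * ∑ s, w s * g a s) ∂μ)
      + (T.card : ℝ) ^ 2 * ∫ y, -Real.log (1 - X y.1 * X y.2) ∂(μ.prod μ) := by
  have hga : ∀ a, 0 ≤ ∑ s, w s * g a s := fun a =>
    Finset.sum_nonneg fun s _ => mul_nonneg (hw s) (hg0 a s)
  have hgab : ∀ a b, 0 ≤ ∑ s, w s * (g a s * g b s) := fun a b =>
    Finset.sum_nonneg fun s _ => mul_nonneg (hw s) (mul_nonneg (hg0 a s) (hg0 b s))
  have hgab' : ∀ a ∈ T, ∀ b, ∑ s, w s * (g a s * g b s) < 1 := fun a ha b =>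
    (Finset.sum_le_sum fun s _ => mul_le_mul_of_nonneg_left
      (mul_le_of_le_one_right (hg0 a s) (hg1 b s)) (hw s)).trans_lt (hlt a ha)
  set m : ℕ → ℝ := fun n => ∫ y, X y ^ (n + 1) ∂μ with hm
  have s1 : HasSum (fun n : ℕ => ∑ a ∈ T, ∑ b ∈ T,
      (∑ s, w s * (g a s * g b s)) ^ (n + 1) / ((n : ℝ) + 1))
      (∑ a ∈ T, ∑ b ∈ T, -Real.log (1 - ∑ s, w s * (g a s * g b s))) :=
    hasSum_sum fun a ha => hasSum_sum fun b _ => Real.hasSum_pow_div_log_of_abs_lt_one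
      (by rw [abs_of_nonneg (hgab a b)]; exact hgab' a ha b)
  have s2 : HasSum (fun n : ℕ => ∑ a ∈ T, m n * (∑ s, w s * g a s) ^ (n + 1) / ((n : ℝ) + 1))
      (∑ a ∈ T, ∫ y, -Real.log (1 - X y * ∑ s, w s * g a s) ∂μ) := by
    refine hasSum_sum fun a ha => ?_
    have := hasSum_integral_neg_log (μ := μ) (X := fun y => X y * ∑ s, w s * g a s)
      (hX.mul_const _)
      (fun y => ⟨mul_nonneg (hX01 y).1.le (hga a),
        (mul_le_of_le_one_left (hga a) (hX01 y).2.le).trans_lt (hlt a ha)⟩)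
      (integrable_log_one_sub_mul hX hX01 (hga a) (hlt a ha)).neg
    simpa only [mul_pow, integral_mul_const] using this
  have s3 : HasSum (fun n : ℕ => m n ^ 2 / ((n : ℝ) + 1))
      (∫ y, -Real.log (1 - X y.1 * X y.2) ∂(μ.prod μ)) := by
    have := hasSum_integral_neg_log (μ := μ.prod μ) (X := fun y => X y.1 * X y.2)
      ((hX.comp measurable_fst).mul (hX.comp measurable_snd))
      (fun y => ⟨mul_nonneg (hX01 _).1.le (hX01 _).1.le,
        mul_lt_one_of_nonneg_of_lt_one_left (hX01 _).1.le (hX01 _).2 (hX01 _).2.le⟩) hi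
    convert this using 2 with n
    simp only [mul_pow]
    rw [integral_prod_mul (fun y => X y ^ (n + 1)) (fun y => X y ^ (n + 1)), sq]
  have s4 := (s1.sub ((s2.mul_left (T.card : ℝ)).mul_left 2)).add
    (s3.mul_left ((T.card : ℝ) ^ 2))
  have h0 := s4.nonneg fun n => ?_
  · simp only [Finset.sum_neg_distrib, integral_neg] at h0 ⊢
    linarith
  · have h := div_nonneg (replica_moment_nonneg w hw hw1 T g (m n) (n + 1))
      (show (0 : ℝ) ≤ (n : ℝ) + 1 by positivity)
    simp only [← Finset.sum_div]
    convert h using 1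
    ring

end Replica

/-! ### The hard-core model with free half-edges and external fields -/

section Gibbs

variable {N d M : ℕ}

/-- The occupation variable, in `{0, 1}`, of the vertex carrying the half-edge in position `p`. -/
def spin (e : (Fin M × Fin 2) ≃ (Fin N × Fin d)) (p : Fin M × Fin 2) (I : Finset (Fin N)) : ℝ :=
  if (e p).1 ∈ I then 1 else 0

/-- The weight of a set `I` of occupied vertices at fugacity `l`: the edges in `K` are present, the
half-edges in the positions `S` feel the fields `y`, all other half-edges are free. -/
noncomputable def weight (l : ℝ) (K : Finset (Fin M)) (S : Finset (Fin M × Fin 2))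
    (e : (Fin M × Fin 2) ≃ (Fin N × Fin d)) (y : Fin N × Fin d → ℝ) (I : Finset (Fin N)) : ℝ :=
  l ^ I.card * (∏ i ∈ K, (1 - spin e (i, 0) I * spin e (i, 1) I)) *
    ∏ p ∈ S, (1 - y (e p) * spin e p I)

/-- The partition function of the interpolating model. -/
noncomputable def partitionFn (l : ℝ) (K : Finset (Fin M)) (S : Finset (Fin M × Fin 2))
    (e : (Fin M × Fin 2) ≃ (Fin N × Fin d)) (y : Fin N × Fin d → ℝ) : ℝ :=
  ∑ I : Finset (Fin N), weight l K S e y I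

/-- The Gibbs measure of the interpolating model. -/
noncomputable def gibbs (l : ℝ) (K : Finset (Fin M)) (S : Finset (Fin M × Fin 2))
    (e : (Fin M × Fin 2) ≃ (Fin N × Fin d)) (y : Fin N × Fin d → ℝ) (I : Finset (Fin N)) : ℝ :=
  weight l K S e y I / partitionFn l K S e y

variable {l : ℝ} {K : Finset (Fin M)} {S : Finset (Fin M × Fin 2)}
  {e : (Fin M × Fin 2) ≃ (Fin N × Fin d)} {y : Fin N × Fin d → ℝ}

lemma spin_nonneg (p : Fin M × Fin 2) (I : Finset (Fin N)) : 0 ≤ spin e p I := by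
  unfold spin; split_ifs <;> norm_num

lemma spin_le_one (p : Fin M × Fin 2) (I : Finset (Fin N)) : spin e p I ≤ 1 := by
  unfold spin; split_ifs <;> norm_num

lemma spin_mono (p : Fin M × Fin 2) {I J : Finset (Fin N)} (h : I ⊆ J) :
    spin e p I ≤ spin e p J := by
  unfold spin
  split_ifs with h1 h2
  · exact le_rfl
  · exact absurd (h h1) h2
  · exact zero_le_one
  · exact le_rfl

lemma edgeFactor_nonneg (p q : Fin M × Fin 2) (I : Finset (Fin N)) :
    0 ≤ 1 - spin e p I * spin e q I :=
  sub_nonneg.2 (mul_le_one₀ (spin_le_one p I) (spin_nonneg q I) (spin_le_one q I))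

lemma fieldFactor_nonneg (hy : ∀ h, y h ∈ Set.Ioo (0 : ℝ) 1) (p : Fin M × Fin 2)
    (I : Finset (Fin N)) : 0 ≤ 1 - y (e p) * spin e p I :=
  sub_nonneg.2 (mul_le_one₀ (hy _).2.le (spin_nonneg p I) (spin_le_one p I))

lemma weight_nonneg (hl : 0 < l) (hy : ∀ h, y h ∈ Set.Ioo (0 : ℝ) 1) (I : Finset (Fin N)) :
    0 ≤ weight l K S e y I :=
  mul_nonneg (mul_nonneg (pow_nonneg hl.le _)
    (Finset.prod_nonneg fun _ _ => edgeFactor_nonneg _ _ I))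
    (Finset.prod_nonneg fun _ _ => fieldFactor_nonneg hy _ I)

lemma weight_empty : weight l K S e y ∅ = 1 := by
  simp [weight, spin]

lemma weight_le_pow (hl : 0 < l) (hy : ∀ h, y h ∈ Set.Ioo (0 : ℝ) 1) (I : Finset (Fin N)) :
    weight l K S e y I ≤ l ^ I.card := by
  rw [weight, mul_assoc]
  refine mul_le_of_le_one_right (pow_nonneg hl.le _) (mul_le_one₀
    (Finset.prod_le_one (fun _ _ => edgeFactor_nonneg _ _ I) fun i _ => ?_)
    (Finset.prod_nonneg fun _ _ => fieldFactor_nonneg hy _ I)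
    (Finset.prod_le_one (fun _ _ => fieldFactor_nonneg hy _ I) fun p _ => ?_))
  · linarith [mul_nonneg (spin_nonneg (e := e) (i, 0) I) (spin_nonneg (e := e) (i, 1) I)]
  · linarith [mul_nonneg (hy (e p)).1.le (spin_nonneg (e := e) p I)]

lemma weight_insert_le (hl : 0 < l) (hy : ∀ h, y h ∈ Set.Ioo (0 : ℝ) 1) {v : Fin N}
    {I : Finset (Fin N)} (hv : v ∉ I) :
    weight l K S e y (insert v I) ≤ l * weight l K S e y I := by
  have hsub : I ⊆ insert v I := Finset.subset_insert v I
  unfold weight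
  rw [Finset.card_insert_of_notMem hv, pow_succ, mul_comm (l ^ I.card) l, mul_assoc, mul_assoc,
    mul_assoc]
  refine mul_le_mul_of_nonneg_left (mul_le_mul_of_nonneg_left ?_ (pow_nonneg hl.le _)) hl.le
  refine mul_le_mul ?_ ?_ (Finset.prod_nonneg fun _ _ => fieldFactor_nonneg hy _ _)
    (Finset.prod_nonneg fun _ _ => edgeFactor_nonneg _ _ I)
  · refine Finset.prod_le_prod (fun _ _ => edgeFactor_nonneg _ _ _) fun i _ => ?_
    exact sub_le_sub_left (mul_le_mul (spin_mono _ hsub) (spin_mono _ hsub) (spin_nonneg _ _)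
      (spin_nonneg _ _)) _
  · refine Finset.prod_le_prod (fun _ _ => fieldFactor_nonneg hy _ _) fun p _ => ?_
    exact sub_le_sub_left (mul_le_mul_of_nonneg_left (spin_mono _ hsub) (hy _).1.le) _

lemma weight_insert_edge {i : Fin M} (hi : i ∉ K) (I : Finset (Fin N)) :
    weight l (insert i K) S e y I =
      weight l K S e y I * (1 - spin e (i, 0) I * spin e (i, 1) I) := by
  unfold weight
  rw [Finset.prod_insert hi]
  ring

lemma weight_insert_field {p : Fin M × Fin 2} (hp : p ∉ S) (I : Finset (Fin N)) :
    weight l K (insert p S) e y I = weight l K S e y I * (1 - y (e p) * spin e p I) := by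
  unfold weight
  rw [Finset.prod_insert hp]
  ring

lemma one_le_partitionFn (hl : 0 < l) (hy : ∀ h, y h ∈ Set.Ioo (0 : ℝ) 1) :
    1 ≤ partitionFn l K S e y := by
  rw [← weight_empty (l := l) (K := K) (S := S) (e := e) (y := y)]
  exact Finset.single_le_sum (fun I _ => weight_nonneg hl hy I) (Finset.mem_univ ∅)

lemma partitionFn_pos (hl : 0 < l) (hy : ∀ h, y h ∈ Set.Ioo (0 : ℝ) 1) :
    0 < partitionFn l K S e y :=
  zero_lt_one.trans_le (one_le_partitionFn hl hy)

lemma gibbs_nonneg (hl : 0 < l) (hy : ∀ h, y h ∈ Set.Ioo (0 : ℝ) 1) (I : Finset (Fin N)) :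
    0 ≤ gibbs l K S e y I :=
  div_nonneg (weight_nonneg hl hy I) (partitionFn_pos hl hy).le

lemma sum_gibbs (hl : 0 < l) (hy : ∀ h, y h ∈ Set.Ioo (0 : ℝ) 1) :
    ∑ I, gibbs l K S e y I = 1 := by
  unfold gibbs
  rw [← Finset.sum_div]
  exact div_self (partitionFn_pos hl hy).ne'

lemma sum_weight_mul (hl : 0 < l) (hy : ∀ h, y h ∈ Set.Ioo (0 : ℝ) 1) (f : Finset (Fin N) → ℝ) :
    ∑ I, weight l K S e y I * (1 - f I) =
      partitionFn l K S e y * (1 - ∑ I, gibbs l K S e y I * f I) := by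
  have h := (partitionFn_pos (K := K) (S := S) (e := e) hl hy).ne'
  have : ∑ I, gibbs l K S e y I * f I =
      (∑ I, weight l K S e y I * f I) / partitionFn l K S e y := by
    rw [Finset.sum_div]
    exact Finset.sum_congr rfl fun I _ => by unfold gibbs; ring
  rw [this, mul_sub, mul_div_cancel₀ _ h, mul_one]
  simp only [mul_sub, mul_one, Finset.sum_sub_distrib]
  rfl

lemma partitionFn_insert_edge (hl : 0 < l) (hy : ∀ h, y h ∈ Set.Ioo (0 : ℝ) 1) {i : Fin M}
    (hi : i ∉ K) : partitionFn l (insert i K) S e y =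
      partitionFn l K S e y *
        (1 - ∑ I, gibbs l K S e y I * (spin e (i, 0) I * spin e (i, 1) I)) := by
  rw [← sum_weight_mul hl hy]
  exact Finset.sum_congr rfl fun I _ => weight_insert_edge hi I

lemma partitionFn_insert_field (hl : 0 < l) (hy : ∀ h, y h ∈ Set.Ioo (0 : ℝ) 1)
    {p : Fin M × Fin 2} (hp : p ∉ S) : partitionFn l K (insert p S) e y =
      partitionFn l K S e y * (1 - y (e p) * ∑ I, gibbs l K S e y I * spin e p I) := by
  have : y (e p) * ∑ I, gibbs l K S e y I * spin e p I =
      ∑ I, gibbs l K S e y I * (y (e p) * spin e p I) := by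
    rw [Finset.mul_sum]
    exact Finset.sum_congr rfl fun I _ => by ring
  rw [this, ← sum_weight_mul hl hy]
  exact Finset.sum_congr rfl fun I _ => weight_insert_field hp I

/-- A vertex is empty with probability at least `1 / (1 + l)`, since removing it from an occupied
set divides the weight by at most `l`. -/
lemma inv_le_one_sub_gibbs_spin (hl : 0 < l) (hy : ∀ h, y h ∈ Set.Ioo (0 : ℝ) 1)
    (p : Fin M × Fin 2) : (1 + l)⁻¹ ≤ 1 - ∑ I, gibbs l K S e y I * spin e p I := by
  set v := (e p).1 with hv
  have h1 : ∑ I, weight l K S e y I * spin e p I =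
      ∑ I ∈ Finset.univ.filter (fun I : Finset (Fin N) => v ∈ I), weight l K S e y I := by
    rw [Finset.sum_filter]
    exact Finset.sum_congr rfl fun I _ => by unfold spin; simp [hv]
  have h2 : ∑ I, weight l K S e y I * (1 - spin e p I) =
      ∑ I ∈ Finset.univ.filter (fun I : Finset (Fin N) => v ∉ I), weight l K S e y I := by
    rw [Finset.sum_filter]
    refine Finset.sum_congr rfl fun I _ => ?_
    unfold spin
    by_cases h : (e p).1 ∈ I <;> simp [hv, h]
  have h3 : ∑ I ∈ Finset.univ.filter (fun I : Finset (Fin N) => v ∈ I), weight l K S e y I =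
      ∑ I ∈ Finset.univ.filter (fun I : Finset (Fin N) => v ∉ I),
        weight l K S e y (insert v I) := by
    refine Finset.sum_nbij' (fun I => I.erase v) (fun I => insert v I) ?_ ?_ ?_ ?_ ?_
    · intro I _; simp
    · intro I _; simp
    · intro I hI; exact Finset.insert_erase (Finset.mem_filter.1 hI).2
    · intro I hI; exact Finset.erase_insert (Finset.mem_filter.1 hI).2
    · intro I hI; simp only [Finset.insert_erase (Finset.mem_filter.1 hI).2]
  have h4 : ∑ I, weight l K S e y I * spin e p I ≤
      l * ∑ I, weight l K S e y I * (1 - spin e p I) := by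
    rw [h1, h2, h3, Finset.mul_sum]
    exact Finset.sum_le_sum fun I hI => weight_insert_le hl hy (Finset.mem_filter.1 hI).2
  have hZ := partitionFn_pos (K := K) (S := S) (e := e) hl hy
  have h5 : ∑ I, weight l K S e y I * spin e p I =
      partitionFn l K S e y - ∑ I, weight l K S e y I * (1 - spin e p I) := by
    simp only [mul_sub, mul_one, Finset.sum_sub_distrib]
    unfold partitionFn
    ring
  rw [h5, sum_weight_mul hl hy] at h4
  rw [inv_le_iff_one_le_mul₀ (by positivity)]
  nlinarith

lemma gibbs_spin_nonneg (hl : 0 < l) (hy : ∀ h, y h ∈ Set.Ioo (0 : ℝ) 1) (p : Fin M × Fin 2) :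
    0 ≤ ∑ I, gibbs l K S e y I * spin e p I :=
  Finset.sum_nonneg fun I _ => mul_nonneg (gibbs_nonneg hl hy I) (spin_nonneg p I)

lemma gibbs_spin_lt_one (hl : 0 < l) (hy : ∀ h, y h ∈ Set.Ioo (0 : ℝ) 1) (p : Fin M × Fin 2) :
    ∑ I, gibbs l K S e y I * spin e p I < 1 := by
  have := inv_le_one_sub_gibbs_spin (K := K) (S := S) (e := e) hl hy p
  have : 0 < (1 + l)⁻¹ := by positivity
  linarith

lemma neg_log_le_log_edge (hl : 0 < l) (hy : ∀ h, y h ∈ Set.Ioo (0 : ℝ) 1)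
    (p q : Fin M × Fin 2) : -Real.log (1 + l) ≤
      Real.log (1 - ∑ I, gibbs l K S e y I * (spin e p I * spin e q I)) := by
  rw [← Real.log_inv]
  refine Real.log_le_log (by positivity)
    ((inv_le_one_sub_gibbs_spin (K := K) (S := S) (e := e) hl hy p).trans ?_)
  exact sub_le_sub_left (Finset.sum_le_sum fun I _ => mul_le_mul_of_nonneg_left
    (mul_le_of_le_one_right (spin_nonneg p I) (spin_le_one q I)) (gibbs_nonneg hl hy I)) _

lemma log_edge_nonpos (hl : 0 < l) (hy : ∀ h, y h ∈ Set.Ioo (0 : ℝ) 1)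
    (p q : Fin M × Fin 2) :
    Real.log (1 - ∑ I, gibbs l K S e y I * (spin e p I * spin e q I)) ≤ 0 := by
  have h0 : 0 ≤ ∑ I, gibbs l K S e y I * (spin e p I * spin e q I) :=
    Finset.sum_nonneg fun I _ => mul_nonneg (gibbs_nonneg hl hy I)
      (mul_nonneg (spin_nonneg p I) (spin_nonneg q I))
  have h1 : ∑ I, gibbs l K S e y I * (spin e p I * spin e q I) ≤ 1 :=
    (Finset.sum_le_sum fun I _ => mul_le_mul_of_nonneg_left
      (mul_le_of_le_one_right (spin_nonneg p I) (spin_le_one q I)) (gibbs_nonneg hl hy I)).trans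
      (gibbs_spin_lt_one hl hy p).le
  exact Real.log_nonpos (by linarith) (by linarith)

lemma neg_log_le_log_field (hl : 0 < l) (hy : ∀ h, y h ∈ Set.Ioo (0 : ℝ) 1)
    (p : Fin M × Fin 2) {t : ℝ} (ht1 : t ≤ 1) :
    -Real.log (1 + l) ≤ Real.log (1 - t * ∑ I, gibbs l K S e y I * spin e p I) := by
  rw [← Real.log_inv]
  refine Real.log_le_log (by positivity)
    ((inv_le_one_sub_gibbs_spin (K := K) (S := S) (e := e) hl hy p).trans ?_)
  exact sub_le_sub_left (mul_le_of_le_one_left (gibbs_spin_nonneg hl hy p) ht1) _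

lemma log_field_nonpos (hl : 0 < l) (hy : ∀ h, y h ∈ Set.Ioo (0 : ℝ) 1)
    (p : Fin M × Fin 2) {t : ℝ} (ht0 : 0 ≤ t) (ht1 : t ≤ 1) :
    Real.log (1 - t * ∑ I, gibbs l K S e y I * spin e p I) ≤ 0 := by
  have h0 := gibbs_spin_nonneg (K := K) (S := S) (e := e) hl hy p
  have h1 := gibbs_spin_lt_one (K := K) (S := S) (e := e) hl hy p
  exact Real.log_nonpos (by nlinarith) (by nlinarith)

lemma partitionFn_le (hl : 0 < l) (hy : ∀ h, y h ∈ Set.Ioo (0 : ℝ) 1) :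
    partitionFn l K S e y ≤ ∑ I : Finset (Fin N), l ^ I.card :=
  Finset.sum_le_sum fun I _ => weight_le_pow hl hy I

lemma continuous_partitionFn (l : ℝ) (K : Finset (Fin M)) (S : Finset (Fin M × Fin 2))
    (e : (Fin M × Fin 2) ≃ (Fin N × Fin d)) : Continuous (partitionFn l K S e) := by
  unfold partitionFn weight
  fun_prop

lemma measurable_gibbs_sum (l : ℝ) (K : Finset (Fin M)) (S : Finset (Fin M × Fin 2))
    (e : (Fin M × Fin 2) ≃ (Fin N × Fin d)) (f : Finset (Fin N) → ℝ) :
    Measurable fun y => ∑ I, gibbs l K S e y I * f I := by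
  have h1 := (continuous_partitionFn l K S e).measurable
  have h2 : ∀ I, Measurable fun y => weight l K S e y I := fun I => by
    refine Continuous.measurable ?_
    unfold weight
    fun_prop
  exact Finset.measurable_sum _ fun I _ => ((h2 I).div h1).mul_const _

/-- Moving the free half-edges does not change the weight, which depends on a configuration only
through the half-edges used by an edge in `K` or by a field. -/
lemma weight_perm (τ : Equiv.Perm (Fin M × Fin 2)) (hK : ∀ i ∈ K, ∀ s, τ (i, s) = (i, s))
    (hS : ∀ p ∈ S, τ p = p) (I : Finset (Fin N)) :
    weight l K S (τ.trans e) y I = weight l K S e y I := by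
  unfold weight spin
  congr 1
  · congr 1
    refine Finset.prod_congr rfl fun i hi => ?_
    simp only [Equiv.trans_apply, hK i hi]
  · refine Finset.prod_congr rfl fun p hp => ?_
    simp only [Equiv.trans_apply, hS p hp]

lemma gibbs_perm (τ : Equiv.Perm (Fin M × Fin 2)) (hK : ∀ i ∈ K, ∀ s, τ (i, s) = (i, s))
    (hS : ∀ p ∈ S, τ p = p) (I : Finset (Fin N)) :
    gibbs l K S (τ.trans e) y I = gibbs l K S e y I := by
  unfold gibbs partitionFn
  simp only [weight_perm τ hK hS]

/-- The Gibbs measure does not depend on the fields outside `S`. -/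
lemma gibbs_update {p : Fin M × Fin 2} (hp : p ∉ S) (t : ℝ) (I : Finset (Fin N)) :
    gibbs l K S e (Function.update y (e p) t) I = gibbs l K S e y I := by
  have : ∀ J, weight l K S e (Function.update y (e p) t) J = weight l K S e y J := by
    intro J
    unfold weight
    congr 1
    refine Finset.prod_congr rfl fun q hq => ?_
    rw [Function.update_of_ne]
    exact fun h => hp (e.injective h ▸ hq)
  unfold gibbs partitionFn
  simp only [this]

end Gibbs

/-! ### One step of the interpolation -/

/-- Resampling one coordinate preserves a product of copies of a probability measure. -/
lemma measurePreserving_update {ι Ω : Type*} [Fintype ι] [DecidableEq ι] [MeasurableSpace Ω]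
    (μ : Measure Ω) [IsProbabilityMeasure μ] (j : ι) :
    MeasurePreserving (fun z : (ι → Ω) × Ω => Function.update z.1 j z.2)
      ((Measure.pi fun _ => μ).prod μ) (Measure.pi fun _ => μ) := by
  have hm : Measurable fun z : (ι → Ω) × Ω => Function.update z.1 j z.2 := by
    refine measurable_pi_iff.2 fun k => ?_
    by_cases h : k = j
    · subst h
      simpa using measurable_snd
    · simp only [Function.update_of_ne h]
      exact (measurable_pi_apply k).comp measurable_fst
  refine ⟨hm, (Measure.pi_eq fun s hs => ?_).symm⟩
  rw [Measure.map_apply hm (MeasurableSet.univ_pi hs)]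
  have : (fun z : (ι → Ω) × Ω => Function.update z.1 j z.2) ⁻¹' Set.univ.pi s =
      (Set.univ.pi (Function.update s j Set.univ)) ×ˢ s j := by
    ext z
    simp only [Set.mem_preimage, Set.mem_pi, Set.mem_univ, forall_true_left, Set.mem_prod]
    constructor
    · intro h
      refine ⟨fun k => ?_, by simpa using h j⟩
      by_cases hk : k = j
      · subst hk; simp
      · simpa [Function.update_of_ne hk] using h k
    · rintro ⟨h, h'⟩ k
      by_cases hk : k = j
      · subst hk; simpa using h'
      · simpa [Function.update_of_ne hk] using h k
  rw [this, Measure.prod_prod, Measure.pi_pi, ← Finset.prod_erase_mul _ _ (Finset.mem_univ j),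
    ← Finset.prod_erase_mul _ _ (Finset.mem_univ j)]
  simp only [Function.update_self, measure_univ, mul_one]
  congr 1
  refine Finset.prod_congr rfl fun k hk => ?_
  rw [Function.update_of_ne (Finset.ne_of_mem_erase hk)]

section Step

variable {N d M : ℕ} {Ω : Type*} [MeasurableSpace Ω]

/-- The expectation over a uniformly random configuration and independent fields of law `μ` on the
half-edges. -/
noncomputable def mean (μ : Measure Ω)
    (F : ((Fin M × Fin 2) ≃ (Fin N × Fin d)) → (Fin N × Fin d → Ω) → ℝ) : ℝ :=
  (∑ e, ∫ x, F e x ∂(Measure.pi fun _ => μ)) / Fintype.card ((Fin M × Fin 2) ≃ (Fin N × Fin d))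

/-- The mean logarithm of the partition function, the field on the half-edge `h` being `X (x h)`. -/
noncomputable def freeEnergy (N d : ℕ) {M : ℕ} (l : ℝ) (μ : Measure Ω) (X : Ω → ℝ)
    (K : Finset (Fin M)) (S : Finset (Fin M × Fin 2)) : ℝ :=
  mean (N := N) (d := d) μ fun e x => Real.log (partitionFn l K S e fun h => X (x h))

/-- The increment of the logarithm of the partition function when the half-edges in the positions
`a` and `b` are joined by an edge. -/
noncomputable def edgeIncrement (l : ℝ) (X : Ω → ℝ) (K : Finset (Fin M))
    (S : Finset (Fin M × Fin 2)) (a b : Fin M × Fin 2) (e : (Fin M × Fin 2) ≃ (Fin N × Fin d))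
    (x : Fin N × Fin d → Ω) : ℝ :=
  Real.log (1 - ∑ I, gibbs l K S e (fun h => X (x h)) I * (spin e a I * spin e b I))

/-- The mean increment of the logarithm of the partition function when a new field acts on the
half-edge in position `a`. -/
noncomputable def fieldIncrement (l : ℝ) (μ : Measure Ω) (X : Ω → ℝ) (K : Finset (Fin M))
    (S : Finset (Fin M × Fin 2)) (a : Fin M × Fin 2) (e : (Fin M × Fin 2) ≃ (Fin N × Fin d))
    (x : Fin N × Fin d → Ω) : ℝ :=
  ∫ t, Real.log (1 - X t * ∑ I, gibbs l K S e (fun h => X (x h)) I * spin e a I) ∂μ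

/-- The positions of the half-edges that are neither on an edge in `K` nor under a field. -/
def freePositions (K : Finset (Fin M)) (S : Finset (Fin M × Fin 2)) : Finset (Fin M × Fin 2) :=
  Finset.univ.filter fun p => p.1 ∉ K ∧ p ∉ S

variable {l : ℝ} {μ : Measure Ω} {X : Ω → ℝ}
  {K : Finset (Fin M)} {S : Finset (Fin M × Fin 2)}

lemma mean_mono {F G : ((Fin M × Fin 2) ≃ (Fin N × Fin d)) → (Fin N × Fin d → Ω) → ℝ}
    (hF : ∀ e, Integrable (F e) (Measure.pi fun _ => μ))
    (hG : ∀ e, Integrable (G e) (Measure.pi fun _ => μ)) (h : ∀ e x, F e x ≤ G e x) :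
    mean μ F ≤ mean μ G :=
  div_le_div_of_nonneg_right
    (Finset.sum_le_sum fun e _ => integral_mono (hF e) (hG e) (h e)) (Nat.cast_nonneg _)

lemma mean_add {F G : ((Fin M × Fin 2) ≃ (Fin N × Fin d)) → (Fin N × Fin d → Ω) → ℝ}
    (hF : ∀ e, Integrable (F e) (Measure.pi fun _ => μ))
    (hG : ∀ e, Integrable (G e) (Measure.pi fun _ => μ)) :
    mean μ (fun e x => F e x + G e x) = mean μ F + mean μ G := by
  unfold mean
  rw [← add_div, ← Finset.sum_add_distrib]
  congr 1
  exact Finset.sum_congr rfl fun e _ => integral_add (hF e) (hG e)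

lemma mean_const_mul (c : ℝ)
    (F : ((Fin M × Fin 2) ≃ (Fin N × Fin d)) → (Fin N × Fin d → Ω) → ℝ) :
    mean μ (fun e x => c * F e x) = c * mean μ F := by
  unfold mean
  simp only [integral_const_mul, ← Finset.mul_sum, mul_div_assoc]

lemma mean_sum {ι : Type*} (T : Finset ι)
    {F : ι → ((Fin M × Fin 2) ≃ (Fin N × Fin d)) → (Fin N × Fin d → Ω) → ℝ}
    (hF : ∀ a ∈ T, ∀ e, Integrable (F a e) (Measure.pi fun _ => μ)) :
    mean μ (fun e x => ∑ a ∈ T, F a e x) = ∑ a ∈ T, mean μ (F a) := by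
  unfold mean
  rw [← Finset.sum_div, Finset.sum_comm]
  congr 1
  exact Finset.sum_congr rfl fun e _ => integral_finsetSum _ fun a ha => hF a ha e

/-- A uniformly random configuration is invariant in law under permutations of the positions. -/
lemma mean_perm (τ : Equiv.Perm (Fin M × Fin 2))
    (F : ((Fin M × Fin 2) ≃ (Fin N × Fin d)) → (Fin N × Fin d → Ω) → ℝ) :
    mean μ (fun e => F (τ.trans e)) = mean μ F := by
  unfold mean
  congr 1
  exact (Equiv.equivCongr τ.symm (Equiv.refl _)).sum_comp
    fun e => ∫ x, F e x ∂(Measure.pi fun _ => μ)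

/-- The free half-edges are exchangeable: the mean edge increment is the same for all pairs. -/
lemma mean_edgeIncrement_eq {i : Fin M} (h0 : (i, 0) ∈ freePositions K S)
    (h1 : (i, 1) ∈ freePositions K S) {a b : Fin M × Fin 2} (ha : a ∈ freePositions K S)
    (hb : b ∈ freePositions K S) (hab : a ≠ b) :
    mean (N := N) (d := d) μ (edgeIncrement l X K S a b) =
      mean (N := N) (d := d) μ (edgeIncrement l X K S (i, 0) (i, 1)) := by
  simp only [freePositions, Finset.mem_filter, Finset.mem_univ, true_and] at h0 h1 ha hb
  -- `τ` moves `(i, 0)` to `a` and `(i, 1)` to `b`, and fixes every position in use.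
  set b' := Equiv.swap (i, (0 : Fin 2)) a b with hb'
  set τ : Equiv.Perm (Fin M × Fin 2) :=
    (Equiv.swap (i, (1 : Fin 2)) b').trans (Equiv.swap (i, (0 : Fin 2)) a) with hτ
  have hne : b' ≠ (i, 0) := by
    rw [hb', Ne, Equiv.swap_apply_eq_iff, Equiv.swap_apply_left]
    exact hab.symm
  have hb'2 : b'.1 ∉ K ∧ b' ∉ S := by
    rw [hb', Equiv.swap_apply_def]
    split_ifs
    exacts [ha, h0, hb]
  have t0 : τ (i, 0) = a := by
    rw [hτ, Equiv.trans_apply, Equiv.swap_apply_of_ne_of_ne (by simp) hne.symm,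
      Equiv.swap_apply_left]
  have t1 : τ (i, 1) = b := by
    rw [hτ, Equiv.trans_apply, Equiv.swap_apply_left, hb', Equiv.swap_apply_self]
  have tfix : ∀ p, ¬ (p.1 ∉ K ∧ p ∉ S) → τ p = p := by
    intro p hp
    have e1 : p ≠ (i, 0) := fun h => hp (h ▸ h0)
    have e2 : p ≠ (i, 1) := fun h => hp (h ▸ h1)
    have e3 : p ≠ a := fun h => hp (h ▸ ha)
    have e4 : p ≠ b' := fun h => hp (h ▸ hb'2)
    rw [hτ, Equiv.trans_apply, Equiv.swap_apply_of_ne_of_ne e2 e4,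
      Equiv.swap_apply_of_ne_of_ne e1 e3]
  rw [← mean_perm τ (edgeIncrement l X K S (i, 0) (i, 1))]
  congr 1
  funext e x
  unfold edgeIncrement
  have hg : ∀ I, gibbs l K S (τ.trans e) (fun h => X (x h)) I =
      gibbs l K S e (fun h => X (x h)) I :=
    gibbs_perm τ (fun j hj s => tfix _ fun h => h.1 hj) (fun p hp => tfix _ fun h => h.2 hp)
  simp only [hg, spin, Equiv.trans_apply, t0, t1]

lemma mean_fieldIncrement_eq {a b : Fin M × Fin 2} (ha : a ∈ freePositions K S)
    (hb : b ∈ freePositions K S) :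
    mean (N := N) (d := d) μ (fieldIncrement l μ X K S a) =
      mean (N := N) (d := d) μ (fieldIncrement l μ X K S b) := by
  simp only [freePositions, Finset.mem_filter, Finset.mem_univ, true_and] at ha hb
  have tfix : ∀ p, ¬ (p.1 ∉ K ∧ p ∉ S) → Equiv.swap a b p = p := fun p hp =>
    Equiv.swap_apply_of_ne_of_ne (fun h => hp (h ▸ ha)) (fun h => hp (h ▸ hb))
  rw [← mean_perm (Equiv.swap a b) (fieldIncrement l μ X K S b)]
  congr 1
  funext e x
  unfold fieldIncrement
  have hg : ∀ I, gibbs l K S ((Equiv.swap a b).trans e) (fun h => X (x h)) I =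
      gibbs l K S e (fun h => X (x h)) I :=
    gibbs_perm _ (fun j hj s => tfix _ fun h => h.1 hj) (fun p hp => tfix _ fun h => h.2 hp)
  simp only [hg, spin, Equiv.trans_apply, Equiv.swap_apply_right]

variable [IsProbabilityMeasure μ]

lemma mean_const [Nonempty ((Fin M × Fin 2) ≃ (Fin N × Fin d))] (c : ℝ) :
    mean (N := N) (d := d) (M := M) μ (fun _ _ => c) = c := by
  unfold mean
  simp only [integral_const, probReal_univ, one_smul, Finset.sum_const, Finset.card_univ,
    nsmul_eq_mul]
  exact mul_div_cancel_left₀ _ (Nat.cast_ne_zero.2 Fintype.card_ne_zero)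

/-! ### Integrability -/

lemma measurable_fields (hX : Measurable X) :
    Measurable fun (x : Fin N × Fin d → Ω) h => X (x h) :=
  measurable_pi_iff.2 fun h => hX.comp (measurable_pi_apply h)

lemma integrable_log_partitionFn (hl : 0 < l) (hX : Measurable X)
    (hX01 : ∀ t, X t ∈ Set.Ioo (0 : ℝ) 1) (K : Finset (Fin M)) (S : Finset (Fin M × Fin 2))
    (e : (Fin M × Fin 2) ≃ (Fin N × Fin d)) :
    Integrable (fun x => Real.log (partitionFn l K S e fun h => X (x h)))
      (Measure.pi fun _ => μ) := by
  refine Integrable.of_bound (Real.measurable_log.comp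
    ((continuous_partitionFn l K S e).measurable.comp (measurable_fields hX))).aestronglyMeasurable
    (Real.log (∑ I : Finset (Fin N), l ^ I.card)) (Eventually.of_forall fun x => ?_)
  have h1 : 1 ≤ partitionFn l K S e fun h => X (x h) := one_le_partitionFn hl fun h => hX01 _
  rw [Real.norm_of_nonneg (Real.log_nonneg h1)]
  exact Real.log_le_log (zero_lt_one.trans_le h1) (partitionFn_le hl fun h => hX01 _)

lemma integrable_edgeIncrement (hl : 0 < l) (hX : Measurable X)
    (hX01 : ∀ t, X t ∈ Set.Ioo (0 : ℝ) 1) (a b : Fin M × Fin 2)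
    (e : (Fin M × Fin 2) ≃ (Fin N × Fin d)) :
    Integrable (edgeIncrement l X K S a b e) (Measure.pi fun _ => μ) := by
  refine Integrable.of_bound (Real.measurable_log.comp (measurable_const.sub
    ((measurable_gibbs_sum l K S e _).comp (measurable_fields hX)))).aestronglyMeasurable
    (Real.log (1 + l)) (Eventually.of_forall fun x => ?_)
  have h1 := neg_log_le_log_edge (K := K) (S := S) (e := e) hl (fun h => hX01 (x h)) a b
  have h2 := log_edge_nonpos (K := K) (S := S) (e := e) hl (fun h => hX01 (x h)) a b
  exact abs_le.2 ⟨h1, h2.trans (Real.log_nonneg (by linarith))⟩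

lemma integrable_log_field (hl : 0 < l) (hX : Measurable X)
    (hX01 : ∀ t, X t ∈ Set.Ioo (0 : ℝ) 1) (a : Fin M × Fin 2)
    (e : (Fin M × Fin 2) ≃ (Fin N × Fin d)) :
    Integrable (fun z : (Fin N × Fin d → Ω) × Ω =>
      Real.log (1 - X z.2 * ∑ I, gibbs l K S e (fun h => X (z.1 h)) I * spin e a I))
      ((Measure.pi fun _ => μ).prod μ) := by
  refine Integrable.of_bound (Real.measurable_log.comp (measurable_const.sub
    ((hX.comp measurable_snd).mul ((measurable_gibbs_sum l K S e _).comp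
      ((measurable_fields hX).comp measurable_fst))))).aestronglyMeasurable
    (Real.log (1 + l)) (Eventually.of_forall fun z => ?_)
  have h1 := neg_log_le_log_field (K := K) (S := S) (e := e) hl (fun h => hX01 (z.1 h)) a
    (hX01 z.2).2.le
  have h2 := log_field_nonpos (K := K) (S := S) (e := e) hl (fun h => hX01 (z.1 h)) a
    (hX01 z.2).1.le (hX01 z.2).2.le
  exact abs_le.2 ⟨h1, h2.trans (Real.log_nonneg (by linarith))⟩

lemma integrable_fieldIncrement (hl : 0 < l) (hX : Measurable X)
    (hX01 : ∀ t, X t ∈ Set.Ioo (0 : ℝ) 1) (a : Fin M × Fin 2)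
    (e : (Fin M × Fin 2) ≃ (Fin N × Fin d)) :
    Integrable (fieldIncrement l μ X K S a e) (Measure.pi fun _ => μ) :=
  (integrable_log_field hl hX hX01 a e).integral_prod_left

/-! ### Increments of the free energy -/

lemma freeEnergy_insert_edge (hl : 0 < l) (hX : Measurable X)
    (hX01 : ∀ t, X t ∈ Set.Ioo (0 : ℝ) 1) {i : Fin M} (hi : i ∉ K) :
    freeEnergy N d l μ X (insert i K) S = freeEnergy N d l μ X K S +
      mean (N := N) (d := d) μ (edgeIncrement l X K S (i, 0) (i, 1)) := by
  unfold freeEnergy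
  rw [← mean_add (integrable_log_partitionFn hl hX hX01 K S)
    (integrable_edgeIncrement hl hX hX01 _ _)]
  congr 1
  funext e x
  rw [partitionFn_insert_edge hl (fun h => hX01 (x h)) hi, Real.log_mul
    (partitionFn_pos hl fun h => hX01 (x h)).ne']
  · rfl
  · have h1 := inv_le_one_sub_gibbs_spin (K := K) (S := S) (e := e) hl (fun h => hX01 (x h)) (i, 0)
    refine ((show (0 : ℝ) < (1 + l)⁻¹ by positivity).trans_le (h1.trans ?_)).ne'
    exact sub_le_sub_left (Finset.sum_le_sum fun I _ => mul_le_mul_of_nonneg_left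
      (mul_le_of_le_one_right (spin_nonneg _ I) (spin_le_one _ I))
      (gibbs_nonneg hl (fun h => hX01 (x h)) I)) _

lemma freeEnergy_insert_field (hl : 0 < l) (hX : Measurable X)
    (hX01 : ∀ t, X t ∈ Set.Ioo (0 : ℝ) 1) {p : Fin M × Fin 2} (hp : p ∉ S) :
    freeEnergy N d l μ X K (insert p S) = freeEnergy N d l μ X K S +
      mean (N := N) (d := d) μ (fieldIncrement l μ X K S p) := by
  unfold freeEnergy
  rw [← mean_add (integrable_log_partitionFn hl hX hX01 K S)
    (integrable_fieldIncrement hl hX hX01 _)]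
  unfold mean
  congr 1
  refine Finset.sum_congr rfl fun e _ => ?_
  rw [integral_add (integrable_log_partitionFn hl hX hX01 K S e)
    (integrable_fieldIncrement hl hX hX01 p e)]
  -- The field on the half-edge `e p` is independent of the Gibbs measure, so it may be resampled.
  set f : (Fin N × Fin d → Ω) → ℝ := fun x =>
    Real.log (1 - X (x (e p)) * ∑ I, gibbs l K S e (fun h => X (x h)) I * spin e p I) with hf
  have hfm : Measurable f := Real.measurable_log.comp (measurable_const.sub
    ((hX.comp (measurable_pi_apply _)).mul ((measurable_gibbs_sum l K S e _).comp
      (measurable_fields hX))))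
  have hupd := measurePreserving_update μ (e p)
  have hf2 : ∀ z : (Fin N × Fin d → Ω) × Ω, f (Function.update z.1 (e p) z.2) =
      Real.log (1 - X z.2 * ∑ I, gibbs l K S e (fun h => X (z.1 h)) I * spin e p I) := by
    intro z
    have h1 : (fun h => X (Function.update z.1 (e p) z.2 h)) =
        Function.update (fun h => X (z.1 h)) (e p) (X z.2) := by
      funext h
      exact Function.apply_update (fun _ => X) z.1 (e p) z.2 h
    simp only [hf, h1, gibbs_update hp, Function.update_self]
  have hfi : Integrable f (Measure.pi fun _ => μ) := by
    rw [← hupd.map_eq, integrable_map_measure hfm.aestronglyMeasurable hupd.aemeasurable]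
    exact (integrable_log_field hl hX hX01 p e).congr (Eventually.of_forall fun z => (hf2 z).symm)
  have hfint : ∫ x, f x ∂(Measure.pi fun _ => μ) =
      ∫ x, fieldIncrement l μ X K S p e x ∂(Measure.pi fun _ => μ) := by
    conv_lhs => rw [← hupd.map_eq]
    rw [integral_map hupd.aemeasurable hfm.aestronglyMeasurable]
    simp only [hf2]
    exact integral_prod _ (integrable_log_field hl hX hX01 p e)
  rw [← hfint, ← integral_add (integrable_log_partitionFn hl hX hX01 K S e) hfi]
  congr 1
  funext x
  beta_reduce
  rw [partitionFn_insert_field hl (fun h => hX01 (x h)) hp, Real.log_mul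
    (partitionFn_pos hl fun h => hX01 (x h)).ne']
  have h0 := gibbs_spin_nonneg (K := K) (S := S) (e := e) hl (fun h => hX01 (x h)) p
  have h1 := gibbs_spin_lt_one (K := K) (S := S) (e := e) hl (fun h => hX01 (x h)) p
  have := mul_le_of_le_one_left h0 (hX01 (x (e p))).2.le
  exact ne_of_gt (by linarith)

/-- The replica inequality for the free half-edges, with the diagonal terms moved to the error. -/
lemma sum_edgeIncrement_le (hl : 0 < l) (hX : Measurable X)
    (hX01 : ∀ t, X t ∈ Set.Ioo (0 : ℝ) 1)
    (hi : Integrable (fun y : Ω × Ω => -Real.log (1 - X y.1 * X y.2)) (μ.prod μ))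
    (T : Finset (Fin M × Fin 2)) (e : (Fin M × Fin 2) ≃ (Fin N × Fin d))
    (x : Fin N × Fin d → Ω) :
    ∑ a ∈ T, ∑ b ∈ T.erase a, edgeIncrement l X K S a b e x ≤
      2 * T.card * ∑ a ∈ T, fieldIncrement l μ X K S a e x +
      ((T.card : ℝ) ^ 2 * (∫ y, -Real.log (1 - X y.1 * X y.2) ∂(μ.prod μ)) +
        T.card * Real.log (1 + l)) := by
  have hy : ∀ h, (fun h => X (x h)) h ∈ Set.Ioo (0 : ℝ) 1 := fun h => hX01 (x h)
  have h1 := replica_inequality hX hX01 hi (gibbs l K S e fun h => X (x h))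
    (gibbs_nonneg hl hy) (sum_gibbs hl hy) T (spin e) spin_nonneg spin_le_one
    (fun a _ => gibbs_spin_lt_one hl hy a)
  have h2 : ∑ a ∈ T, ∑ b ∈ T, edgeIncrement l X K S a b e x =
      ∑ a ∈ T, ∑ b ∈ T.erase a, edgeIncrement l X K S a b e x +
        ∑ a ∈ T, edgeIncrement l X K S a a e x := by
    rw [← Finset.sum_add_distrib]
    exact Finset.sum_congr rfl fun a ha => (Finset.sum_erase_add _ _ ha).symm
  have h3 : T.card * -Real.log (1 + l) ≤ ∑ a ∈ T, edgeIncrement l X K S a a e x := by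
    rw [← nsmul_eq_mul]
    exact Finset.card_nsmul_le_sum _ _ _ fun a _ => neg_log_le_log_edge hl hy a a
  have h4 : ∑ a ∈ T, ∑ b ∈ T, edgeIncrement l X K S a b e x ≤
      2 * (T.card * ∑ a ∈ T, fieldIncrement l μ X K S a e x)
      + (T.card : ℝ) ^ 2 * ∫ y, -Real.log (1 - X y.1 * X y.2) ∂(μ.prod μ) := h1
  linarith

lemma mean_fieldIncrement_bounds [Nonempty ((Fin M × Fin 2) ≃ (Fin N × Fin d))] (hl : 0 < l)
    (hX : Measurable X) (hX01 : ∀ t, X t ∈ Set.Ioo (0 : ℝ) 1) (p : Fin M × Fin 2) :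
    -Real.log (1 + l) ≤ mean (N := N) (d := d) μ (fieldIncrement l μ X K S p) ∧
      mean (N := N) (d := d) μ (fieldIncrement l μ X K S p) ≤ 0 := by
  have hint : ∀ (e : (Fin M × Fin 2) ≃ (Fin N × Fin d)) (x : Fin N × Fin d → Ω),
      Integrable (fun t => Real.log (1 - X t * ∑ I, gibbs l K S e (fun h => X (x h)) I *
        spin e p I)) μ := fun e x =>
    integrable_log_one_sub_mul hX hX01 (gibbs_spin_nonneg hl (fun h => hX01 (x h)) p)
      (gibbs_spin_lt_one hl (fun h => hX01 (x h)) p)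
  constructor
  · conv_lhs => rw [← mean_const (N := N) (d := d) (M := M) (μ := μ) (-Real.log (1 + l))]
    refine mean_mono (fun e => integrable_const _) (integrable_fieldIncrement hl hX hX01 p)
      fun e x => ?_
    have : ∫ _, -Real.log (1 + l) ∂μ = -Real.log (1 + l) := by simp
    rw [← this]
    exact integral_mono (integrable_const _) (hint e x) fun t =>
      neg_log_le_log_field hl (fun h => hX01 (x h)) p (hX01 t).2.le
  · conv_rhs => rw [← mean_const (N := N) (d := d) (M := M) (μ := μ) 0]
    refine mean_mono (integrable_fieldIncrement hl hX hX01 p) (fun e => integrable_const _)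
      fun e x => ?_
    exact integral_nonpos fun t =>
      log_field_nonpos hl (fun h => hX01 (x h)) p (hX01 t).1.le (hX01 t).2.le

/-- One step of the interpolation: adding one edge changes the free energy at most by twice the
change due to one field, up to the edge term of the replica-symmetric functional and an error
inversely proportional to the number `r` of half-edges that stay free when the field is added. -/
lemma freeEnergy_step [Nonempty ((Fin M × Fin 2) ≃ (Fin N × Fin d))] (hl : 0 < l)
    (hX : Measurable X) (hX01 : ∀ t, X t ∈ Set.Ioo (0 : ℝ) 1)
    (hi : Integrable (fun y : Ω × Ω => -Real.log (1 - X y.1 * X y.2)) (μ.prod μ))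
    {i : Fin M} (h0 : (i, 0) ∈ freePositions K S) (h1 : (i, 1) ∈ freePositions K S)
    {p : Fin M × Fin 2} (hp : p ∈ freePositions K S) {r : ℕ} (hr : 0 < r)
    (hcard : (freePositions K S).card = r + 1) :
    freeEnergy N d l μ X (insert i K) S + freeEnergy N d l μ X K S ≤
      2 * freeEnergy N d l μ X K (insert p S) +
      ((∫ y, -Real.log (1 - X y.1 * X y.2) ∂(μ.prod μ)) +
        ((∫ y, -Real.log (1 - X y.1 * X y.2) ∂(μ.prod μ)) + Real.log (1 + l)) / r) := by
  set γ := ∫ y, -Real.log (1 - X y.1 * X y.2) ∂(μ.prod μ) with hγ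
  set T := freePositions K S with hT
  have hiK : i ∉ K := by
    simp only [hT, freePositions, Finset.mem_filter] at h0
    exact h0.2.1
  have hpS : p ∉ S := by
    simp only [hT, freePositions, Finset.mem_filter] at hp
    exact hp.2.2
  rw [freeEnergy_insert_edge hl hX hX01 hiK, freeEnergy_insert_field hl hX hX01 hpS]
  set E := mean (N := N) (d := d) μ (edgeIncrement l X K S (i, 0) (i, 1)) with hE
  set F := mean (N := N) (d := d) μ (fieldIncrement l μ X K S p) with hF
  have hF0 : F ≤ 0 := (mean_fieldIncrement_bounds hl hX hX01 p).2
  have iE := fun a b => integrable_edgeIncrement (μ := μ) (N := N) (d := d) (K := K) (S := S)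
    hl hX hX01 a b
  have iF := fun a => integrable_fieldIncrement (μ := μ) (N := N) (d := d) (K := K) (S := S)
    hl hX hX01 a
  have hmain := mean_mono (μ := μ)
    (fun e => integrable_finsetSum T fun a _ => integrable_finsetSum (T.erase a) fun b _ =>
      iE a b e)
    (fun e => ((integrable_finsetSum T fun a _ => iF a e).const_mul (2 * (T.card : ℝ))).add
      (integrable_const ((T.card : ℝ) ^ 2 * γ + T.card * Real.log (1 + l))))
    (sum_edgeIncrement_le (K := K) (S := S) (N := N) (d := d) hl hX hX01 hi T)
  have hL : mean (N := N) (d := d) μ (fun e x => ∑ a ∈ T, ∑ b ∈ T.erase a,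
      edgeIncrement l X K S a b e x) = (r + 1) * (r * E) := by
    rw [mean_sum T fun a _ e => integrable_finsetSum (T.erase a) fun b _ => iE a b e]
    have : ∀ a ∈ T, mean (N := N) (d := d) μ (fun e x => ∑ b ∈ T.erase a,
        edgeIncrement l X K S a b e x) = r * E := by
      intro a ha
      rw [mean_sum (T.erase a) fun b _ e => iE a b e, Finset.sum_congr rfl fun b hb =>
        mean_edgeIncrement_eq h0 h1 ha (Finset.mem_of_mem_erase hb)
          (Finset.ne_of_mem_erase hb).symm, Finset.sum_const, Finset.card_erase_of_mem ha, hcard,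
        nsmul_eq_mul, Nat.add_sub_cancel]
    rw [Finset.sum_congr rfl this, Finset.sum_const, hcard, nsmul_eq_mul]
    push_cast
    ring
  have hR : mean (N := N) (d := d) μ (fun e x => 2 * (T.card : ℝ) * ∑ a ∈ T,
      fieldIncrement l μ X K S a e x + ((T.card : ℝ) ^ 2 * γ + T.card * Real.log (1 + l))) =
      2 * (r + 1) * ((r + 1) * F) + ((r + 1) ^ 2 * γ + (r + 1) * Real.log (1 + l)) := by
    rw [mean_add (fun e => (integrable_finsetSum T fun a _ => iF a e).const_mul _)
      (fun e => integrable_const _), mean_const, mean_const_mul, mean_sum T fun a _ e => iF a e,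
      Finset.sum_congr rfl fun a ha => mean_fieldIncrement_eq ha hp, Finset.sum_const, hcard,
      nsmul_eq_mul]
    push_cast
    ring
  have hmain2 : (r + 1) * (r * E) ≤
      2 * (r + 1) * ((r + 1) * F) + ((r + 1) ^ 2 * γ + (r + 1) * Real.log (1 + l)) := by
    rw [← hL, ← hR]; exact hmain
  have hr' : (0 : ℝ) < r := Nat.cast_pos.2 hr
  have hmain3 : (r : ℝ) * E ≤ 2 * ((r + 1) * F) + ((r + 1) * γ + Real.log (1 + l)) := by
    refine le_of_mul_le_mul_left ?_ (show (0 : ℝ) < r + 1 by positivity)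
    linarith
  have hmain4 : E ≤ 2 * F + (γ + (γ + Real.log (1 + l)) / r) := by
    refine le_of_mul_le_mul_left ?_ hr'
    have : (r : ℝ) * (2 * F + (γ + (γ + Real.log (1 + l)) / r)) =
        2 * (r * F) + (r * γ + (γ + Real.log (1 + l))) := by
      field_simp
    rw [this]
    linarith
  linarith

end Step

/-! ### The interpolation -/

section Interpolation

variable {N d M : ℕ} {Ω : Type*} [MeasurableSpace Ω]

/-- The first `k` edges. -/
def edgesBelow (M k : ℕ) : Finset (Fin M) := Finset.univ.filter fun i => i.val < k

/-- The last `f` positions, in the order in which `(i, s)` has rank `2 i + s`. -/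
def fieldsAbove (M f : ℕ) : Finset (Fin M × Fin 2) :=
  Finset.univ.filter fun p => 2 * M ≤ 2 * p.1.val + p.2.val + f

lemma edgesBelow_succ {k : ℕ} (hk : k < M) :
    insert ⟨k, hk⟩ (edgesBelow M k) = edgesBelow M (k + 1) := by
  ext i
  simp only [edgesBelow, Finset.mem_insert, Finset.mem_filter, Finset.mem_univ, true_and,
    Fin.ext_iff]
  omega

lemma exists_fieldsAbove_succ {f : ℕ} (hf : f < 2 * M) :
    ∃ p : Fin M × Fin 2, 2 * p.1.val + p.2.val + f + 1 = 2 * M ∧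
      insert p (fieldsAbove M f) = fieldsAbove M (f + 1) := by
  refine ⟨(⟨(2 * M - f - 1) / 2, by omega⟩, ⟨(2 * M - f - 1) % 2, by omega⟩), ?_, ?_⟩
  · simp only; omega
  · ext ⟨i, s⟩
    simp only [fieldsAbove, Finset.mem_insert, Finset.mem_filter, Finset.mem_univ, true_and,
      Prod.ext_iff, Fin.ext_iff]
    omega

lemma mem_freePositions {k f : ℕ} {p : Fin M × Fin 2} :
    p ∈ freePositions (edgesBelow M k) (fieldsAbove M f) ↔
      2 * k ≤ 2 * p.1.val + p.2.val ∧ 2 * p.1.val + p.2.val + f < 2 * M := by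
  simp only [freePositions, edgesBelow, fieldsAbove, Finset.mem_filter, Finset.mem_univ, true_and]
  omega

lemma card_freePositions (M k f : ℕ) :
    (freePositions (edgesBelow M k) (fieldsAbove M f)).card = 2 * M - f - 2 * k := by
  rw [← Nat.card_Ico]
  refine Finset.card_bij (fun p _ => 2 * p.1.val + p.2.val) ?_ ?_ ?_
  · intro p hp
    rw [mem_freePositions] at hp
    rw [Finset.mem_Ico]
    omega
  · rintro ⟨i, s⟩ _ ⟨j, t⟩ _ h
    simp only at h
    simp only [Prod.ext_iff, Fin.ext_iff]
    omega
  · intro n hn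
    rw [Finset.mem_Ico] at hn
    refine ⟨(⟨n / 2, by omega⟩, ⟨n % 2, by omega⟩), ?_, ?_⟩
    · rw [mem_freePositions]
      simp only
      omega
    · simp only
      omega

/-- A function that is bounded below, starts with a drop of at least `L`, and is superharmonic up
to `ε` even after adding `C / (2 r)`. Evaluated at the number of free half-edges it pays for the
errors of the interpolation: it is a parabola minus a convex function which is curved where
`C / r` exceeds `ε` and linear beyond. -/
lemma exists_barrier {C L ε : ℝ} (hC : 0 ≤ C) (hL : 0 ≤ L) (hε : 0 < ε) :
    ∃ (q : ℕ → ℝ) (B : ℝ), q 0 = 0 ∧ q 1 + L ≤ 0 ∧ (∀ r, -B ≤ q r) ∧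
      ∀ r : ℕ, 0 < r → (q (r + 1) + q (r - 1)) / 2 + C / r / 2 ≤ q r + ε := by
  obtain ⟨R, hR⟩ := exists_nat_gt (C / ε)
  -- `2 A` is the second difference of the convex part up to `R`, which has to be at least `C / r`;
  -- `A` is also its slope at `0`, which makes for the initial drop.
  set A := C + L + ε with hA
  have hA0 : 0 < A := by positivity
  set g : ℕ → ℝ := fun j => A * (2 * (min j R : ℕ) + 1) with hg
  set q : ℕ → ℝ := fun r => ε / 2 * (r : ℝ) ^ 2 - ∑ j ∈ Finset.range r, g j with hq
  have hgle : ∀ j, g j ≤ A * (2 * R + 1) := fun j => by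
    refine mul_le_mul_of_nonneg_left ?_ hA0.le
    have : ((min j R : ℕ) : ℝ) ≤ R := by exact_mod_cast min_le_right j R
    linarith
  refine ⟨q, (A * (2 * R + 1)) ^ 2 / (2 * ε), by simp [hq], ?_, ?_, ?_⟩
  · simp only [hq, hg, Finset.sum_range_one, Nat.cast_one, Nat.zero_min, Nat.cast_zero]
    nlinarith
  · intro r
    have h1 : ∑ j ∈ Finset.range r, g j ≤ r * (A * (2 * R + 1)) := by
      have := Finset.sum_le_card_nsmul (Finset.range r) g _ fun j _ => hgle j
      rwa [Finset.card_range, nsmul_eq_mul] at this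
    set D := A * (2 * R + 1) with hD
    have h2 : -(D ^ 2 / (2 * ε)) + (ε * r - D) ^ 2 / (2 * ε) = ε / 2 * (r : ℝ) ^ 2 - r * D := by
      field_simp
      ring
    have h3 : 0 ≤ (ε * r - D) ^ 2 / (2 * ε) := by positivity
    simp only [hq]
    linarith
  · intro r hr
    obtain ⟨n, rfl⟩ : ∃ n, r = n + 1 := ⟨r - 1, by omega⟩
    have e : (q (n + 1 + 1) + q (n + 1 - 1)) / 2 = q (n + 1) + ε / 2 - (g (n + 1) - g n) / 2 := by
      simp only [hq, Nat.add_sub_cancel, Finset.sum_range_succ]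
      push_cast
      ring
    rw [e]
    have hn : (0 : ℝ) < ((n + 1 : ℕ) : ℝ) := by positivity
    rcases le_or_gt (n + 1) R with h | h
    · have h1 : g (n + 1) - g n = 2 * A := by
        simp only [hg, min_eq_left h, min_eq_left (show n ≤ R by omega)]
        push_cast
        ring
      have h2 : C / ((n + 1 : ℕ) : ℝ) ≤ C := div_le_self hC (by exact_mod_cast Nat.succ_pos n)
      rw [h1]
      linarith
    · have h1 : g (n + 1) - g n = 0 := by
        simp only [hg, min_eq_right h.le, min_eq_right (show R ≤ n by omega), sub_self]
      have h2 : C / ((n + 1 : ℕ) : ℝ) ≤ ε := by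
        rw [div_le_iff₀ hn]
        rw [div_lt_iff₀ hε] at hR
        have : (R : ℝ) ≤ ((n + 1 : ℕ) : ℝ) := by exact_mod_cast h.le
        nlinarith
      rw [h1]
      linarith

variable {l : ℝ} {μ : Measure Ω} [IsProbabilityMeasure μ] {X : Ω → ℝ}

lemma freeEnergy_insert_edge_le [Nonempty ((Fin M × Fin 2) ≃ (Fin N × Fin d))] (hl : 0 < l)
    (hX : Measurable X) (hX01 : ∀ t, X t ∈ Set.Ioo (0 : ℝ) 1) {K : Finset (Fin M)}
    {S : Finset (Fin M × Fin 2)} {i : Fin M} (hi : i ∉ K) :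
    freeEnergy N d l μ X (insert i K) S ≤ freeEnergy N d l μ X K S := by
  rw [freeEnergy_insert_edge hl hX hX01 hi]
  refine add_le_of_nonpos_right ?_
  conv_rhs => rw [← mean_const (N := N) (d := d) (M := M) (μ := μ) 0]
  exact mean_mono (integrable_edgeIncrement hl hX hX01 _ _) (fun e => integrable_const _)
    fun e x => log_edge_nonpos hl (fun h => hX01 (x h)) _ _

lemma freeEnergy_univ_le [Nonempty ((Fin M × Fin 2) ≃ (Fin N × Fin d))] (hl : 0 < l)
    (hX : Measurable X) (hX01 : ∀ t, X t ∈ Set.Ioo (0 : ℝ) 1) (S : Finset (Fin M × Fin 2))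
    {k : ℕ} (hk : k ≤ M) :
    freeEnergy N d l μ X Finset.univ S ≤ freeEnergy N d l μ X (edgesBelow M k) S := by
  induction hk using Nat.decreasingInduction with
  | self =>
    have : edgesBelow M M = Finset.univ := Finset.filter_true_of_mem fun i _ => i.2
    rw [this]
  | of_succ k hk ih =>
    rw [← edgesBelow_succ hk] at ih
    exact ih.trans (freeEnergy_insert_edge_le hl hX hX01 (by simp [edgesBelow]))

/-- The states of the interpolation with one field less are averaged over the presence of one more
edge, so that the number of free half-edges performs a simple random walk, reflected at `0`, and
the barrier `q` controls the accumulated errors. -/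
lemma freeEnergy_interpolation [Nonempty ((Fin M × Fin 2) ≃ (Fin N × Fin d))] (hl : 0 < l)
    (hX : Measurable X) (hX01 : ∀ t, X t ∈ Set.Ioo (0 : ℝ) 1)
    (hi : Integrable (fun y : Ω × Ω => -Real.log (1 - X y.1 * X y.2)) (μ.prod μ))
    {γ ε B : ℝ} (hγ : γ = ∫ y, -Real.log (1 - X y.1 * X y.2) ∂(μ.prod μ)) (hγ0 : 0 ≤ γ)
    (hε : 0 < ε) {q : ℕ → ℝ} (hq0 : q 0 = 0) (hq1 : q 1 + Real.log (1 + l) ≤ 0)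
    (hqB : ∀ r, -B ≤ q r)
    (hq : ∀ r : ℕ, 0 < r →
      (q (r + 1) + q (r - 1)) / 2 + (γ + Real.log (1 + l)) / r / 2 ≤ q r + ε)
    (f : ℕ) : ∀ k : ℕ, 2 * k + f ≤ 2 * M →
    freeEnergy N d l μ X (Finset.univ : Finset (Fin M)) ∅ - B ≤
      freeEnergy N d l μ X (edgesBelow M k) (fieldsAbove M f) + q (2 * M - f - 2 * k) +
        f * (γ / 2 + ε) := by
  induction f with
  | zero =>
    intro k hk
    have h1 : fieldsAbove M 0 = ∅ := by
      refine Finset.filter_false_of_mem fun p _ => ?_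
      omega
    have h2 := freeEnergy_univ_le (N := N) (d := d) (μ := μ) hl hX hX01 (M := M) ∅
      (show k ≤ M by omega)
    rw [h1]
    have := hqB (2 * M - 0 - 2 * k)
    push_cast
    linarith
  | succ f ih =>
    intro k hk
    obtain ⟨p, hp, hpins⟩ := exists_fieldsAbove_succ (M := M) (f := f) (by omega)
    have hpfree : p ∈ freePositions (edgesBelow M k) (fieldsAbove M f) := by
      rw [mem_freePositions]; omega
    have ih0 := ih k (by omega)
    rw [← hpins]
    rcases Nat.eq_zero_or_pos (2 * M - (f + 1) - 2 * k) with hr | hr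
    -- With no half-edge left free, only the move that removes the field is possible; its cost, at most
    -- `log (1 + l)`, is covered by the drop of `q` between `0` and `1`.
    · have h1 : 2 * M - f - 2 * k = 1 := by omega
      have h2 := (mean_fieldIncrement_bounds (N := N) (d := d) (μ := μ) (K := edgesBelow M k)
        (S := fieldsAbove M f) hl hX hX01 p).1
      rw [freeEnergy_insert_field hl hX hX01 (by simp only [fieldsAbove, Finset.mem_filter]; omega),
        hr, hq0]
      rw [h1] at ih0
      push_cast
      linarith
    · set r := 2 * M - (f + 1) - 2 * k with hrdef
      have hk1 : k < M := by omega
      have ih1 := ih (k + 1) (by omega)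
      have hstep := freeEnergy_step (N := N) (d := d) (μ := μ) (K := edgesBelow M k)
        (S := fieldsAbove M f) hl hX hX01 hi (i := ⟨k, hk1⟩)
        (by rw [mem_freePositions]; simp only [Fin.val_zero]; omega)
        (by rw [mem_freePositions]; simp only [Fin.val_one]; omega) hpfree hr
        (by rw [card_freePositions]; omega)
      rw [edgesBelow_succ, ← hγ] at hstep
      rw [show 2 * M - f - 2 * k = r + 1 by omega] at ih0
      rw [show 2 * M - f - 2 * (k + 1) = r - 1 by omega] at ih1
      have hqr := hq r hr
      push_cast
      linarith

/-! ### The replica-symmetric functional -/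

/-- With fields on all half-edges and no edges the vertices are independent. -/
lemma partitionFn_fields (l : ℝ) (e : (Fin M × Fin 2) ≃ (Fin N × Fin d))
    (y : Fin N × Fin d → ℝ) :
    partitionFn l ∅ Finset.univ e y = ∏ v, (1 + l * ∏ i, (1 - y (v, i))) := by
  rw [Finset.prod_one_add, Finset.powerset_univ]
  refine Finset.sum_congr rfl fun I _ => ?_
  unfold weight spin
  rw [Finset.prod_empty, mul_one, e.prod_comp fun h : Fin N × Fin d =>
    1 - y h * if h.1 ∈ I then (1 : ℝ) else 0, Fintype.prod_prod_type, Finset.prod_mul_distrib,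
    Finset.prod_const]
  congr 1
  rw [← Finset.prod_subset (Finset.subset_univ I)]
  · refine Finset.prod_congr rfl fun v hv => ?_
    simp [hv]
  · intro v _ hv
    simp [hv]

/-- A slice of a family of independent variables has the product law. -/
lemma measurePreserving_slice (μ : Measure Ω) [IsProbabilityMeasure μ] (v : Fin N) :
    MeasurePreserving (fun (x : Fin N × Fin d → Ω) i => x (v, i)) (Measure.pi fun _ => μ)
      (Measure.pi fun _ => μ) := by
  have hm : Measurable fun (x : Fin N × Fin d → Ω) i => x (v, i) :=
    measurable_pi_iff.2 fun i => measurable_pi_apply (v, i)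
  refine ⟨hm, (Measure.pi_eq fun s hs => ?_).symm⟩
  rw [Measure.map_apply hm (MeasurableSet.univ_pi hs)]
  have : (fun (x : Fin N × Fin d → Ω) i => x (v, i)) ⁻¹' Set.univ.pi s =
      Set.univ.pi fun h => if h.1 = v then s h.2 else Set.univ := by
    ext x
    simp only [Set.mem_preimage, Set.mem_pi, Set.mem_univ, forall_true_left]
    constructor
    · rintro h ⟨w, i⟩
      split_ifs with hw
      · simp only at hw
        subst hw
        exact h i
      · trivial
    · intro h i
      simpa using h (v, i)
  rw [this, Measure.pi_pi, Fintype.prod_prod_type, Finset.prod_eq_single v]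
  · simp
  · intro w _ hw
    simp [hw]
  · simp

lemma freeEnergy_fields [Nonempty ((Fin M × Fin 2) ≃ (Fin N × Fin d))] (hl : 0 < l)
    (hX : Measurable X) (hX01 : ∀ t, X t ∈ Set.Ioo (0 : ℝ) 1) :
    freeEnergy N d l μ X (∅ : Finset (Fin M)) Finset.univ =
      N * ∫ p : Fin d → Ω, Real.log (1 + l * ∏ i, (1 - X (p i))) ∂(Measure.pi fun _ => μ) := by
  set F : (Fin d → Ω) → ℝ := fun p => Real.log (1 + l * ∏ i, (1 - X (p i))) with hF
  have hprod : ∀ p : Fin d → Ω, 0 ≤ ∏ i, (1 - X (p i)) ∧ ∏ i, (1 - X (p i)) ≤ 1 := fun p =>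
    ⟨Finset.prod_nonneg fun i _ => by linarith [(hX01 (p i)).2],
      Finset.prod_le_one (fun i _ => by linarith [(hX01 (p i)).2])
        fun i _ => by linarith [(hX01 (p i)).1]⟩
  have hFm : Measurable F := Real.measurable_log.comp (measurable_const.add
    (measurable_const.mul (Finset.measurable_prod _ fun i _ =>
      measurable_const.sub (hX.comp (measurable_pi_apply i)))))
  have hFi : Integrable F (Measure.pi fun _ => μ) := by
    refine Integrable.of_bound hFm.aestronglyMeasurable (Real.log (1 + l))
      (Eventually.of_forall fun p => ?_)
    have h1 := mul_nonneg hl.le (hprod p).1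
    have h2 := mul_le_of_le_one_right hl.le (hprod p).2
    rw [Real.norm_of_nonneg (Real.log_nonneg (by linarith))]
    exact Real.log_le_log (by linarith) (by linarith)
  have hlog : ∀ (e : (Fin M × Fin 2) ≃ (Fin N × Fin d)) (x : Fin N × Fin d → Ω),
      Real.log (partitionFn l ∅ Finset.univ e fun h => X (x h)) =
        ∑ v, F fun i => x (v, i) := by
    intro e x
    rw [partitionFn_fields, Real.log_prod fun v _ => ?_]
    have := mul_nonneg hl.le (hprod fun i => x (v, i)).1
    exact ne_of_gt (by linarith)
  have hslice : ∀ v : Fin N, ∫ x : Fin N × Fin d → Ω, F (fun i => x (v, i))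
      ∂(Measure.pi fun _ => μ) = ∫ p, F p ∂(Measure.pi fun _ => μ) := by
    intro v
    have hv := measurePreserving_slice (N := N) (d := d) μ v
    rw [← hv.map_eq, integral_map hv.aemeasurable]
    rw [hv.map_eq]
    exact hFm.aestronglyMeasurable
  have hint : ∫ x : Fin N × Fin d → Ω, ∑ v, F (fun i => x (v, i)) ∂(Measure.pi fun _ => μ) =
      N * ∫ p, F p ∂(Measure.pi fun _ => μ) := by
    have hsi : ∀ v : Fin N, Integrable (fun x : Fin N × Fin d → Ω => F fun i => x (v, i))
        (Measure.pi fun _ => μ) := fun v =>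
      (measurePreserving_slice (N := N) (d := d) μ v).integrable_comp_of_integrable hFi
    rw [integral_finsetSum _ fun v _ => hsi v]
    simp only [hslice, Finset.sum_const, Finset.card_univ, Fintype.card_fin, nsmul_eq_mul]
  unfold freeEnergy mean
  simp only [hlog, hint, Finset.sum_const, Finset.card_univ, nsmul_eq_mul]
  exact mul_div_cancel_left₀ _ (Nat.cast_ne_zero.2 Fintype.card_ne_zero)

/-- The replica-symmetric upper bound on the mean free energy, with an error `o(N)`. -/
lemma freeEnergy_le (hl : 0 < l) (hX : Measurable X) (hX01 : ∀ t, X t ∈ Set.Ioo (0 : ℝ) 1)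
    (hi : Integrable (fun y : Ω × Ω => -Real.log (1 - X y.1 * X y.2)) (μ.prod μ))
    {ε : ℝ} (hε : 0 < ε) : ∃ B : ℝ, ∀ N d M : ℕ,
      Nonempty ((Fin M × Fin 2) ≃ (Fin N × Fin d)) →
      freeEnergy N d l μ X (Finset.univ : Finset (Fin M)) ∅ ≤
        N * (∫ p : Fin d → Ω, Real.log (1 + l * ∏ i, (1 - X (p i))) ∂(Measure.pi fun _ => μ)) +
        (2 * M : ℕ) * ((∫ y, -Real.log (1 - X y.1 * X y.2) ∂(μ.prod μ)) / 2 + ε) + B := by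
  have hγ0 : 0 ≤ ∫ y, -Real.log (1 - X y.1 * X y.2) ∂(μ.prod μ) :=
    integral_nonneg fun y => by
      have h1 := hX01 y.1
      have h2 := hX01 y.2
      have h3 := mul_pos h1.1 h2.1
      have h4 := mul_lt_one_of_nonneg_of_lt_one_left h1.1.le h1.2 h2.2.le
      exact neg_nonneg.2 (Real.log_nonpos (by linarith) (by linarith))
  have hL : 0 ≤ Real.log (1 + l) := Real.log_nonneg (by linarith)
  obtain ⟨q, B, hq0, hq1, hqB, hq⟩ := exists_barrier (add_nonneg hγ0 hL) hL hε
  refine ⟨B, fun N d M _ => ?_⟩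
  have h := freeEnergy_interpolation (N := N) (d := d) (M := M) hl hX hX01 hi rfl hγ0 hε hq0 hq1
    hqB hq (2 * M) 0 (by omega)
  have e1 : edgesBelow M 0 = ∅ := Finset.filter_false_of_mem fun i _ => by omega
  have e2 : fieldsAbove M (2 * M) = Finset.univ := Finset.filter_true_of_mem fun p _ => by omega
  rw [e1, e2, freeEnergy_fields hl hX hX01, show 2 * M - 2 * M - 2 * 0 = 0 by omega, hq0] at h
  linarith

end Interpolation

/-! ### The independence ratio -/

lemma exists_isIndep_card_eq_maxIndep {d N : ℕ} (m : Config d N) :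
    ∃ I : Finset (Fin N), IsIndep m I ∧ I.card = maxIndep m := by
  have hne : (Finset.univ.filter fun I : Finset (Fin N) => IsIndep m I).Nonempty :=
    ⟨∅, Finset.mem_filter.2 ⟨Finset.mem_univ _, fun k h => by simp at h⟩⟩
  obtain ⟨I, hI, h⟩ := Finset.exists_mem_eq_sup _ hne Finset.card
  exact ⟨I, (Finset.mem_filter.1 hI).2, h.symm⟩

lemma maxIndep_le {d N : ℕ} (m : Config d N) : maxIndep m ≤ N := by
  obtain ⟨I, _, hI⟩ := exists_isIndep_card_eq_maxIndep m
  rw [← hI]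
  simpa using Finset.card_le_univ I

lemma maxIndep_mul_log_le {d N : ℕ} {l : ℝ} (hl : 0 < l) (m : Config d N)
    {y : Fin N × Fin d → ℝ} (hy : ∀ h, y h ∈ Set.Ioo (0 : ℝ) 1) :
    maxIndep m * Real.log l ≤ Real.log (partitionFn l Finset.univ ∅ m y) := by
  obtain ⟨I, hI, hcard⟩ := exists_isIndep_card_eq_maxIndep m
  rw [← Real.log_pow, ← hcard]
  refine Real.log_le_log (pow_pos hl _) ?_
  have hw : weight l Finset.univ ∅ m y I = l ^ I.card := by
    unfold weight
    rw [Finset.prod_empty, mul_one, Finset.prod_eq_one, mul_one]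
    intro k _
    have := hI k
    unfold endpoint at this
    unfold spin
    split_ifs with h0 h1
    · exact absurd ⟨h0, h1⟩ this
    all_goals simp
  rw [← hw]
  exact Finset.single_le_sum (fun J _ => weight_nonneg hl hy J) (Finset.mem_univ I)

lemma nonempty_config {d N : ℕ} (h : Even (d * N)) : Nonempty (Config d N) := by
  refine ⟨Fintype.equivOfCardEq ?_⟩
  simp only [Fintype.card_prod, Fintype.card_fin]
  rw [Nat.div_mul_cancel h.two_dvd, mul_comm]

lemma meanRatio_nonneg (d N : ℕ) : 0 ≤ meanRatio d N := by
  unfold meanRatio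
  positivity

lemma meanRatio_le_one (d N : ℕ) : meanRatio d N ≤ 1 := by
  unfold meanRatio
  refine div_le_one_of_le₀ (div_le_of_le_mul₀ (Nat.cast_nonneg _) (Nat.cast_nonneg _) ?_)
    (Nat.cast_nonneg _)
  refine (Finset.sum_le_card_nsmul _ _ (N : ℝ) fun m _ => ?_).trans ?_
  · exact_mod_cast maxIndep_le m
  · rw [nsmul_eq_mul, Finset.card_univ, mul_comm]

lemma neBot_even_mul (d : ℕ) : NeBot (atTop ⊓ 𝓟 {N : ℕ | Even (d * N)}) := by
  rw [← frequently_mem_iff_neBot, frequently_atTop]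
  exact fun a => ⟨2 * a, by omega, ⟨d * a, by ring⟩⟩

lemma isBoundedUnder_meanRatio (d : ℕ) (F : Filter ℕ) :
    F.IsBoundedUnder (· ≤ ·) fun N => meanRatio d N :=
  isBoundedUnder_of ⟨1, meanRatio_le_one d⟩

lemma alphaStar_nonneg (d : ℕ) : 0 ≤ alphaStar d := by
  have := neBot_even_mul d
  exact le_limsup_of_frequently_le
    (Eventually.of_forall (meanRatio_nonneg d)).frequently (isBoundedUnder_meanRatio d _)

lemma alphaStar_le_of_eventually {d : ℕ} {c : ℝ}
    (h : ∀ᶠ N in atTop ⊓ 𝓟 {N : ℕ | Even (d * N)}, meanRatio d N ≤ c) : alphaStar d ≤ c := by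
  have := neBot_even_mul d
  exact limsup_le_of_le
    (isBoundedUnder_of ⟨0, meanRatio_nonneg d⟩ : IsBoundedUnder (· ≥ ·) _ _).isCoboundedUnder_le h

section Bound

variable {Ω : Type*} [MeasurableSpace Ω] {μ : Measure Ω} [IsProbabilityMeasure μ] {X : Ω → ℝ}
  {l : ℝ}

lemma meanRatio_mul_log_le {d N : ℕ} (hN : 0 < N) (he : Even (d * N)) (hl : 0 < l)
    (hX : Measurable X) (hX01 : ∀ t, X t ∈ Set.Ioo (0 : ℝ) 1) :
    meanRatio d N * Real.log l * N ≤
      freeEnergy N d l μ X (Finset.univ : Finset (Fin (d * N / 2))) ∅ := by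
  have := nonempty_config he
  have hN' : (N : ℝ) ≠ 0 := Nat.cast_ne_zero.2 hN.ne'
  have h1 : meanRatio d N * Real.log l * N =
      mean (N := N) (d := d) μ fun (m : Config d N) _ => Real.log l * maxIndep m := by
    unfold meanRatio mean
    simp only [integral_const, probReal_univ, one_smul, ← Finset.mul_sum]
    field_simp
  rw [h1]
  refine mean_mono (fun e => integrable_const _)
    (integrable_log_partitionFn hl hX hX01 _ _) fun e x => ?_
  rw [mul_comm]
  exact maxIndep_mul_log_le hl e fun h => hX01 (x h)

/-- The bound on the independence ratio when the right-hand side is finite: the largest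
independent set alone contributes `l ^ maxIndep m` to the partition function. -/
lemma alphaStar_mul_log_le (d : ℕ) (hl : 1 < l) (hX : Measurable X)
    (hX01 : ∀ t, X t ∈ Set.Ioo (0 : ℝ) 1)
    (hi : Integrable (fun y : Ω × Ω => -Real.log (1 - X y.1 * X y.2)) (μ.prod μ)) :
    alphaStar d * Real.log l ≤
      ∫ p : Fin d → Ω, Real.log (1 + l * ∏ i, (1 - X (p i))) ∂(Measure.pi fun _ => μ) +
        d / 2 * ∫ y, -Real.log (1 - X y.1 * X y.2) ∂(μ.prod μ) := by
  have hl0 : 0 < l := by linarith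
  have hlog : 0 < Real.log l := Real.log_pos hl
  set A := ∫ p : Fin d → Ω, Real.log (1 + l * ∏ i, (1 - X (p i))) ∂(Measure.pi fun _ => μ)
  set γ := ∫ y, -Real.log (1 - X y.1 * X y.2) ∂(μ.prod μ) with hγ
  refine le_of_forall_pos_le_add fun δ hδ => ?_
  rw [← le_div_iff₀ hlog]
  refine alphaStar_le_of_eventually ?_
  obtain ⟨B, hB⟩ := freeEnergy_le (μ := μ) hl0 hX hX01 hi
    (ε := δ / (2 * (d + 1))) (by positivity)
  obtain ⟨N₀, hN₀⟩ := exists_nat_gt (2 * B / δ)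
  rw [eventually_inf_principal]
  filter_upwards [eventually_ge_atTop (max N₀ 1)] with N hN he
  have hN1 : 0 < N := lt_of_lt_of_le zero_lt_one ((le_max_right _ _).trans hN)
  have hN2 : (0 : ℝ) < N := Nat.cast_pos.2 hN1
  have hN3 : (N₀ : ℝ) ≤ N := by exact_mod_cast (le_max_left _ _).trans hN
  have h1 := (meanRatio_mul_log_le (μ := μ) hN1 he hl0 hX hX01).trans
    (hB N d (d * N / 2) (nonempty_config he))
  rw [Nat.mul_div_cancel' (Even.two_dvd he), ← hγ] at h1
  have h2 : B ≤ N * (δ / 2) := by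
    rw [div_lt_iff₀ hδ] at hN₀
    nlinarith
  have h3 : (d : ℝ) * (δ / (2 * (d + 1))) ≤ δ / 2 := by
    rw [mul_div_assoc', div_le_div_iff₀ (by positivity) (by norm_num)]
    nlinarith [Nat.cast_nonneg (α := ℝ) d]
  have h4 := mul_le_mul_of_nonneg_left h3 hN2.le
  rw [le_div_iff₀ hlog]
  refine le_of_mul_le_mul_right ?_ hN2
  push_cast at h1
  calc meanRatio d N * Real.log l * N ≤ _ := h1
    _ ≤ (A + d / 2 * γ + δ) * N := by linarith

end Bound

/-- A measurable modification of the identity with values in `(0, 1)`, equal to it on `(0, 1)`. -/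
noncomputable def clip (p : ℝ) : ℝ := if p ∈ Set.Ioo (0 : ℝ) 1 then p else 1 / 2

lemma measurable_clip : Measurable clip :=
  Measurable.ite measurableSet_Ioo measurable_id measurable_const

lemma clip_mem_Ioo (p : ℝ) : clip p ∈ Set.Ioo (0 : ℝ) 1 := by
  unfold clip
  split_ifs with h
  · exact h
  · constructor <;> norm_num

lemma rsBound_eq_clip (d : ℕ) (l : ℝ) {η : Measure ℝ} [IsProbabilityMeasure η]
    (hη : ∀ᵐ p ∂η, p ∈ Set.Ioo (0 : ℝ) 1) :
    rsBound d l η =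
      ((∫ p : Fin d → ℝ, Real.log (1 + l * ∏ i, (1 - clip (p i))) ∂(Measure.pi fun _ => η) : ℝ) :
        EReal) + (((d : ℝ) / 2 : ℝ) : EReal) *
      ((∫⁻ q : ℝ × ℝ, ENNReal.ofReal (-Real.log (1 - clip q.1 * clip q.2)) ∂(η.prod η) : ENNReal) :
        EReal) := by
  have hc : ∀ᵐ p ∂η, clip p = p := hη.mono fun p hp => if_pos hp
  have h1 : ∫ p : Fin d → ℝ, Real.log (1 + l * ∏ i, (1 - p i)) ∂(Measure.pi fun _ => η) =
      ∫ p : Fin d → ℝ, Real.log (1 + l * ∏ i, (1 - clip (p i))) ∂(Measure.pi fun _ => η) := by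
    refine integral_congr_ae ?_
    have : ∀ᵐ p : Fin d → ℝ ∂(Measure.pi fun _ => η), ∀ i, clip (p i) = p i :=
      eventually_all.2 fun i => (Measure.quasiMeasurePreserving_eval (fun _ => η) i).ae hc
    filter_upwards [this] with p hp
    simp only [hp]
  have h2 : ∫⁻ q : ℝ × ℝ, ENNReal.ofReal (-Real.log (1 - q.1 * q.2)) ∂(η.prod η) =
      ∫⁻ q : ℝ × ℝ, ENNReal.ofReal (-Real.log (1 - clip q.1 * clip q.2)) ∂(η.prod η) := by
    refine lintegral_congr_ae ?_
    filter_upwards [Measure.quasiMeasurePreserving_fst.ae hc,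
      Measure.quasiMeasurePreserving_snd.ae hc] with q hq1 hq2
    rw [hq1, hq2]
  unfold rsBound
  rw [h1, h2]

lemma neg_log_clip_nonneg (q : ℝ × ℝ) : 0 ≤ -Real.log (1 - clip q.1 * clip q.2) := by
  have h1 := clip_mem_Ioo q.1
  have h2 := clip_mem_Ioo q.2
  have h3 := mul_pos h1.1 h2.1
  have h4 := mul_lt_one_of_nonneg_of_lt_one_left h1.1.le h1.2 h2.2.le
  exact neg_nonneg.2 (Real.log_nonpos (by linarith) (by linarith))

/-- For `l ≤ 1` the left-hand side is non-positive and the right-hand side non-negative; for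
`1 < l` with a finite right-hand side the bound comes from the interpolation. -/
lemma alphaStar_mul_log_le_rsBound {d : ℕ} (hd : 1 ≤ d) {l : ℝ} (hl : 0 < l) {η : Measure ℝ}
    [IsProbabilityMeasure η] (hη : ∀ᵐ p ∂η, p ∈ Set.Ioo (0 : ℝ) 1) :
    ((alphaStar d * Real.log l : ℝ) : EReal) ≤ rsBound d l η := by
  have hd' : (0 : ℝ) < d / 2 := by
    have : (0 : ℝ) < d := by exact_mod_cast hd
    positivity
  rw [rsBound_eq_clip d l hη]
  rcases le_or_gt l 1 with h1 | h1
  · have hL : alphaStar d * Real.log l ≤ 0 :=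
      mul_nonpos_of_nonneg_of_nonpos (alphaStar_nonneg d) (Real.log_nonpos hl.le h1)
    have hR : 0 ≤ ∫ p : Fin d → ℝ, Real.log (1 + l * ∏ i, (1 - clip (p i)))
        ∂(Measure.pi fun _ => η) := by
      refine integral_nonneg fun p => Real.log_nonneg ?_
      have : 0 ≤ ∏ i, (1 - clip (p i)) :=
        Finset.prod_nonneg fun i _ => by linarith [(clip_mem_Ioo (p i)).2]
      linarith [mul_nonneg hl.le this]
    refine le_trans (EReal.coe_le_coe_iff.2 hL) (add_nonneg (EReal.coe_nonneg.2 hR)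
      (mul_nonneg (EReal.coe_nonneg.2 hd'.le) (EReal.coe_ennreal_nonneg _)))
  · by_cases htop : ∫⁻ q : ℝ × ℝ, ENNReal.ofReal (-Real.log (1 - clip q.1 * clip q.2))
        ∂(η.prod η) = ⊤
    · rw [htop, EReal.coe_ennreal_top, EReal.coe_mul_top_of_pos hd', EReal.coe_add_top]
      exact le_top
    · have hm : Measurable fun q : ℝ × ℝ => -Real.log (1 - clip q.1 * clip q.2) :=
        (Real.measurable_log.comp (measurable_const.sub ((measurable_clip.comp measurable_fst).mul
          (measurable_clip.comp measurable_snd)))).neg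
      have hi : Integrable (fun q : ℝ × ℝ => -Real.log (1 - clip q.1 * clip q.2)) (η.prod η) := by
        refine ⟨hm.aestronglyMeasurable, ?_⟩
        rw [hasFiniteIntegral_iff_ofReal (Eventually.of_forall neg_log_clip_nonneg)]
        exact lt_top_iff_ne_top.2 htop
      rw [← ofReal_integral_eq_lintegral_ofReal hi (Eventually.of_forall neg_log_clip_nonneg),
        EReal.coe_ennreal_ofReal, max_eq_left (integral_nonneg neg_log_clip_nonneg)]
      exact_mod_cast alphaStar_mul_log_le d h1 measurable_clip clip_mem_Ioo hi

lemma rsBound_dirac (d : ℕ) (l : ℝ) {p : ℝ} (hp0 : 0 < p) (hp1 : p < 1) :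
    rsBound d l (Measure.dirac p) =
      ((Real.log (1 + l * (1 - p) ^ d) - (d : ℝ) / 2 * Real.log (1 - p ^ 2) : ℝ) : EReal) := by
  have hlog : 0 ≤ -Real.log (1 - p * p) :=
    neg_nonneg.2 (Real.log_nonpos (by nlinarith) (by nlinarith))
  have hpi : (Measure.pi fun _ : Fin d => Measure.dirac p) = Measure.dirac fun _ => p :=
    Measure.pi_eq fun s hs => by
      rw [Measure.dirac_apply' _ (MeasurableSet.univ_pi hs),
        Finset.prod_congr rfl fun i _ => Measure.dirac_apply' p (hs i)]
      by_cases h : ∀ i, p ∈ s i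
      · simp [h]
      · obtain ⟨i, hi⟩ := not_forall.1 h
        rw [Finset.prod_eq_zero (Finset.mem_univ i) (by simp [hi]), Set.indicator_of_notMem]
        exact fun h' => hi (h' i (Set.mem_univ i))
  unfold rsBound
  rw [hpi, Measure.dirac_prod_dirac, integral_dirac, lintegral_dirac]
  simp only [Finset.prod_const, Finset.card_univ, Fintype.card_fin]
  rw [EReal.coe_ennreal_ofReal, max_eq_left hlog]
  norm_cast
  congr 1
  ring_nf

/-- A negative value of `phi` forces `1 < l`, and then the replica-symmetric bound at a Dirac mass
gives `alphaStar d < a`. -/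
lemma alphaStar_lt_of_phiInf_neg {d : ℕ} (hd : 1 ≤ d) {a : ℝ} (ha : 0 < a)
    (h : phiInf d a < 0) : alphaStar d < a := by
  obtain ⟨l, p, hl, hp0, hp1, hphi⟩ := phiInf_lt_zero_iff.1 h
  have hmain := alphaStar_mul_log_le_rsBound hd hl (η := Measure.dirac p)
    ((ae_dirac_iff measurableSet_Ioo).2 ⟨hp0, hp1⟩)
  rw [rsBound_dirac d l hp0 hp1, EReal.coe_le_coe_iff] at hmain
  unfold phi at hphi
  have h1 : 0 ≤ Real.log (1 + l * (1 - p) ^ d) := by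
    have : 0 < (1 - p) ^ d := pow_pos (by linarith) d
    exact Real.log_nonneg (by nlinarith)
  have h2 : Real.log (1 - p ^ 2) ≤ 0 := Real.log_nonpos (by nlinarith) (by nlinarith)
  have h3 : (d : ℝ) / 2 * Real.log (1 - p ^ 2) ≤ 0 :=
    mul_nonpos_of_nonneg_of_nonpos (by positivity) h2
  have h4 : 0 < Real.log l := by
    by_contra hneg
    have := mul_nonpos_of_nonneg_of_nonpos ha.le (not_lt.1 hneg)
    linarith
  exact lt_of_mul_lt_mul_right (by linarith) h4.le

lemma alphaStar_le_alphaRS {d : ℕ} (hd : 1 ≤ d) : alphaStar d ≤ alphaRS d := by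
  refine le_csInf ?_ fun a ha => (alphaStar_lt_of_phiInf_neg hd ha.1 ha.2).le
  have hlog : 0 < Real.log 2 := Real.log_pos (by norm_num)
  obtain ⟨n, hn⟩ := exists_nat_gt
    ((Real.log (1 + 2 * (1 - 1 / 2) ^ d) - (d : ℝ) / 2 * Real.log (1 - (1 / 2) ^ 2)) /
      Real.log 2)
  rw [div_lt_iff₀ hlog] at hn
  refine ⟨n + 1, by positivity, phiInf_lt_zero_iff.2
    ⟨2, 1 / 2, by norm_num, by norm_num, by norm_num, ?_⟩⟩
  unfold phi
  linarith

end HardCore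

theorem mainTheorem5 (d : ℕ) (hd : 1 ≤ d) :
    (∀ (l : ℝ), 0 < l → ∀ (η : Measure ℝ), IsProbabilityMeasure η →
      (∀ᵐ p ∂η, p ∈ Set.Ioo (0 : ℝ) 1) →
      ((HardCore.alphaStar d * Real.log l : ℝ) : EReal) ≤ HardCore.rsBound d l η) ∧
    HardCore.alphaStar d ≤ HardCore.alphaRS d ∧
    (∀ a ∈ Set.Ioo (0 : ℝ) (1 / 2),
      HardCore.phiInf d a = ((HardCore.firstMoment d a : ℝ) : EReal)) ∧
    (3 ≤ d → HardCore.alphaRS d ∈ Set.Ioo (0 : ℝ) (1 / 2) ∧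
      HardCore.alphaRS d =
        sInf {a : ℝ | a ∈ Set.Ioo (0 : ℝ) (1 / 2) ∧ HardCore.firstMoment d a < 0}) :=
  ⟨fun _ hl _ _ hη => HardCore.alphaStar_mul_log_le_rsBound hd hl hη,
    HardCore.alphaStar_le_alphaRS hd, fun _ ha => HardCore.phiInf_eq_firstMoment ha,
    fun h3 => ⟨HardCore.alphaRS_mem_Ioo h3, HardCore.alphaRS_eq_sInf h3⟩⟩
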